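/- **Setting.** Let $V$ be a finite set with $m$ elements, let $\Pi$ be the uniform distribution on $V$, and for a real $V\times V$ matrix $S$ put $\|S\|_{L_2(\Pi^2)}^2=m^{-2}\sum_{u,v\in V}S(u,v)^2$. Let $\|S\|_1={\rm tr}|S|$ be the nuclear norm. Let $\{e_v\}_{v\in V}$ be the canonical basis of $\mathbb R^V$, and let $P_L$ be the orthogonal projector onto a subspace $L\subset\mathbb R^V$. Let $W=\sum_{k=1}^m\lambda_k(\phi_k\otimes\phi_k)$ be a symmetric nonnegative definite $V\times V$ matrix (for instance $W=d\Delta^p$ with $\Delta$ the Laplacian of a graph on $V$ and $d,p>0$), where $0\le\lambda_1\le\dots\le\lambda_m$ and $\phi_1,\dots,\phi_m$ are orthonormal. Suppose that $W\neq 0$, let $k_0$ be the smallest $k$ with $\lambda_k>0$, and put $\lambda_{m+1}^{-1}:=0$. Assume that for some $\zeta\ge 1$ and $c>0$ * $\lambda_m\le m^{\zeta}$ and $\lambda_{k_0}\ge m^{-\zeta}$; * $k\mapsto k/\lambda_k$ is nonincreasing on $\{k_0,\dots,m\}$; * $\lambda_{k+1}\le c\lambda_k$ for $k_0\le k\le m-1$;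 * $\sum_{k=s}^m\lambda_k^{-1}\le c\,s/\lambda_s$ for $k_0\le s\le m$. Let $S_*$ be a symmetric kernel on $V\times V$ of rank $r\ge1$, and let $L={\rm supp}(S_*)$ be the linear span of its eigenvectors with nonzero eigenvalues. Let $(X_j,X_j',Y_j)$, $j=1,\dots,n$, be i.i.d. triples in $V\times V\times\{-1,1\}$, where $X_j,X_j'$ are independent with distribution $\Pi$ and $\mathbb E(Y_j\mid X_j=u,X_j'=v)=S_*(u,v)$. Let $\mathbb D$ be a closed convex set of symmetric kernels with $S_*\in\mathbb D$. For $t>0$ let $$t_{n,m}=t+\log\bigl(2m(\log_2(4n^{\zeta}m^{(3/2)\zeta})+2)\bigr),\qquad \varepsilon=4\sqrt{\frac{t+\log(2m)}{nm}},$$ assume $m\,t_{n,m}\le n$, and for $\bar\varepsilon>0$ let $$\hat S=\mathop{\rm argmin}_{S\in\mathbb D}\Bigl[\|S\|_{L_2(\Pi^2)}^2-\frac2n\sum_{j=1}^nY_jS(X_j,X_j')+\varepsilon\|S\|_1+\bar\varepsilon\|W^{1/2}S\|_{L_2(\Pi^2)}^2\Bigr].$$ **Corollary 1.** There are constants $C,C_1>0$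 depending only on $c$ such that the following holds in this setting. Suppose that, for some $\nu\ge1$, the weak low coherence condition $$\sum_{j=1}^k\|P_L\phi_j\|^2\le\frac{\nu rk}{m},\qquad k=1,\dots,m,$$ holds. Then for all $s\in\{k_0+1,\dots,m+1\}$ and all $\bar\varepsilon\in(\lambda_s^{-1},\lambda_{s-1}^{-1}]$, with probability at least $1-e^{-t}$, $$\|\hat S-S_*\|_{L_2(\Pi^2)}^2\le C\,\frac{\nu r s\,t_{n,m}}{n}+\bar\varepsilon\,\|W^{1/2}S_*\|_{L_2(\Pi^2)}^2+C_1\max_{v\in V}\|P_Le_v\|^2\Bigl(\frac{m\,t_{n,m}}{n}\Bigr)^2 .$$ -/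

import Mathlib

open MeasureTheory ProbabilityTheory
open scoped MatrixOrder

noncomputable section

namespace SimilarityKernel

variable {V : Type*} [Fintype V] [DecidableEq V]

/-- The squared norm `‖S‖²` in `L₂(Π²)`, where `Π` is the uniform distribution on `V`:
the average of `S(u,v)²` over all pairs `(u,v)`. -/
def l2Sq (S : Matrix V V ℝ) : ℝ :=
  (∑ u, ∑ v, S u v ^ 2) / (Fintype.card V : ℝ) ^ 2

/-- The nuclear norm `tr |S|`, with `|S| = √(Sᵀ S)`. -/
def nuclearNorm (S : Matrix V V ℝ) : ℝ :=
  (CFC.abs S).trace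

/-- The support of a symmetric kernel: the linear span of the eigenvectors that belong to
nonzero eigenvalues. -/
def supp (S : Matrix V V ℝ) : Submodule ℝ (EuclideanSpace ℝ V) :=
  Submodule.span ℝ {ψ | ∃ σ : ℝ, σ ≠ 0 ∧ Matrix.toEuclideanLin S ψ = σ • ψ}

/-- `‖P_L x‖²`, the squared Euclidean norm of the orthogonal projection of `x` onto `L`. -/
def projSq (L : Submodule ℝ (EuclideanSpace ℝ V)) (x : EuclideanSpace ℝ V) : ℝ :=
  ‖L.starProjection x‖ ^ 2

/-- `max_{v ∈ V} ‖P_L e_v‖²` for the canonical basis `(e_v)`. -/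
def maxCoherence (L : Submodule ℝ (EuclideanSpace ℝ V)) : ℝ :=
  ⨆ v : V, projSq L (EuclideanSpace.single v 1)

/-- A spectral representation `W = ∑_{k=1}^m λ_k (φ_k ⊗ φ_k)`, `m = card V`, with
`0 ≤ λ_1 ≤ ⋯ ≤ λ_m` and `φ_1, …, φ_m` orthonormal. Only the indices `1, …, m` matter. -/
structure IsSpectralRepr (W : Matrix V V ℝ) (lam : ℕ → ℝ) (phi : ℕ → EuclideanSpace ℝ V) :
    Prop where
  nonneg : ∀ k ∈ Finset.Icc 1 (Fintype.card V), 0 ≤ lam k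
  mono : ∀ k ∈ Finset.Icc 1 (Fintype.card V), ∀ l ∈ Finset.Icc 1 (Fintype.card V),
    k ≤ l → lam k ≤ lam l
  orthonormal : Orthonormal ℝ (fun k : Finset.Icc 1 (Fintype.card V) => phi k)
  eq_sum : W = ∑ k ∈ Finset.Icc 1 (Fintype.card V),
    lam k • Matrix.vecMulVec (phi k).ofLp (phi k).ofLp

/-- The conditions on the spectrum `λ_1 ≤ ⋯ ≤ λ_m`; `k₀` is the smallest index of a positive
eigenvalue. -/
structure SpectrumCondition (m : ℕ) (lam : ℕ → ℝ) (k₀ : ℕ) (ζ c : ℝ) : Prop where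
  isLeast : IsLeast {k | k ∈ Finset.Icc 1 m ∧ 0 < lam k} k₀
  le_top : lam m ≤ (m : ℝ) ^ ζ
  ge_bot : (m : ℝ) ^ (-ζ) ≤ lam k₀
  ratio_antitone : ∀ k, k₀ ≤ k → k + 1 ≤ m → ((k + 1 : ℕ) : ℝ) / lam (k + 1) ≤ (k : ℝ) / lam k
  growth : ∀ k, k₀ ≤ k → k + 1 ≤ m → lam (k + 1) ≤ c * lam k
  tail : ∀ s, k₀ ≤ s → s ≤ m → ∑ k ∈ Finset.Icc s m, 1 / lam k ≤ c * ((s : ℝ) / lam s)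

/-- `λ_s⁻¹`, with the convention `λ_{m+1}⁻¹ = 0`. -/
def invEig (m : ℕ) (lam : ℕ → ℝ) (s : ℕ) : ℝ :=
  if s ≤ m then (lam s)⁻¹ else 0

/-- `t_{n,m} = t + log (2 m (log₂ (4 n^ζ m^{3ζ/2}) + 2))`. -/
def tnm (t ζ : ℝ) (n m : ℕ) : ℝ :=
  t + Real.log (2 * m * (Real.logb 2 (4 * (n : ℝ) ^ ζ * (m : ℝ) ^ (3 / 2 * ζ)) + 2))

/-- The regularization parameter `ε = 4 √((t + log (2m)) / (n m))`. -/
def regEps (t : ℝ) (n m : ℕ) : ℝ :=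
  4 * Real.sqrt ((t + Real.log (2 * m)) / (n * m))

/-- The penalized empirical risk
`‖S‖²_{L₂(Π²)} - (2/n) ∑ⱼ yⱼ S(xⱼ, x'ⱼ) + ε ‖S‖₁ + ε̄ ‖W^{1/2} S‖²_{L₂(Π²)}`. -/
def risk {n : ℕ} (W : Matrix V V ℝ) (ε εbar : ℝ) (x x' : Fin n → V) (y : Fin n → ℝ)
    (S : Matrix V V ℝ) : ℝ :=
  l2Sq S - 2 / (n : ℝ) * ∑ j, y j * S (x j) (x' j) + ε * nuclearNorm S
    + εbar * l2Sq (CFC.sqrt W * S)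

/-- `(X_j, X'_j, Y_j)`, `j < n`, are independent; in each triple `X_j` and `X'_j` are independent
and uniform on `V`, `Y_j ∈ {-1, 1}`, and `E(Y_j | X_j = u, X'_j = v) = S⋆(u, v)`. These properties
determine the law of a triple, so the triples are identically distributed. -/
structure IsSample [MeasurableSpace V] {Ω : Type*} [MeasurableSpace Ω] (μ : Measure Ω) {n : ℕ}
    (Sstar : Matrix V V ℝ) (X X' : Fin n → Ω → V) (Y : Fin n → Ω → ℝ) : Prop where
  law_fst : ∀ j, HasLaw (X j) (uniformOn Set.univ) μ
  law_snd : ∀ j, HasLaw (X' j) (uniformOn Set.univ) μ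
  indep_pair : ∀ j, IndepFun (X j) (X' j) μ
  measurable_fst : ∀ j, Measurable (X j)
  measurable_snd : ∀ j, Measurable (X' j)
  measurable_label : ∀ j, Measurable (Y j)
  label : ∀ j ω, Y j ω = -1 ∨ Y j ω = 1
  regression : ∀ j u v, ∫ ω, Y j ω ∂(μ[|X j ⁻¹' {u} ∩ X' j ⁻¹' {v}]) = Sstar u v
  indep : iIndepFun (fun j ω => (X j ω, X' j ω, Y j ω)) μ

end SimilarityKernel

end

/-! Write Δ = Ŝ - S⋆, and let N be the noise matrix (`noise`), the sum of the centred observations.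
The risk is a quadratic plus convex terms, so minimality tested along the segment from Ŝ to S⋆
bounds 2‖Δ‖² + ε̄‖W^{1/2}Δ‖² by (2/n)⟨N, Δ⟩ + ε(‖S⋆‖₁ - ‖Ŝ‖₁) + ε̄‖W^{1/2}S⋆‖² (`basic_inequality`).

Let P be the projector onto L, Q = 1 - P, and G the sign of S⋆. The subgradient inequality for the
nuclear norm (`IsSignOf.nuclearNorm_add_le`) replaces the difference of nuclear norms by -⟨G, Δ⟩ -
‖QΔQ‖₁. The block QNQ of the noise pairs only with QΔQ and is cancelled once (2/n)‖N‖ ≤ ε. The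
remaining pairings of Δ with G, PN and QNP are estimated by Cauchy–Schwarz for the norm ‖Δ‖² +
ε̄‖W^{1/2}Δ‖², which is present on the left; its dual carries the weight (1 + ε̄W)⁻¹ = CCᵀ
(`oracle_inequality`). Only fixed functions of N remain, so no supremum over Δ has to be controlled.

The effective dimension ‖C‖_F² = ∑ 1/(1 + ε̄λ_k) is at most (1 + c)s (`sum_inv_one_add_le`). Low
coherence and Abel summation give ‖GC‖_F² ≤ (νr/m)‖C‖_F² (`sum_mul_le_of_partial_sums`). The
weighted Frobenius norms of PN and QNP obey Bernstein bounds with variance at most r‖C‖_F²/m² per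
observation and uniform bound max ‖P e_v‖², which produce the first and the last term of the result.

One observation takes finitely many values, so all probabilities are finite sums of products of
weights. The matrix Bernstein inequality is derived from the Golden–Thompson inequality, itself
obtained from the Lie–Trotter formula and a trace inequality for dyadic powers. -/

noncomputable section

namespace SimilarityKernel

/-! ### The Lie–Trotter product formula. -/

section LieTrotter

open Filter Topology Asymptotics

variable {𝔸 : Type*} [NormedRing 𝔸] [NormOneClass 𝔸]

/-- Telescoping. The exponent n in place of n - 1 costs nothing because M ≥ 1. -/
lemma norm_pow_sub_pow_le {x y : 𝔸} {M : ℝ} (hM : 1 ≤ M) (hx : ‖x‖ ≤ M) (hy : ‖y‖ ≤ M) (n : ℕ) :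
    ‖x ^ n - y ^ n‖ ≤ n * M ^ n * ‖x - y‖ := by
  induction n with
  | zero => simp
  | succ n ih =>
    have e : x ^ (n + 1) - y ^ (n + 1) = x * (x ^ n - y ^ n) + (x - y) * y ^ n := by
      rw [pow_succ', pow_succ']; noncomm_ring
    have h1 : ‖x * (x ^ n - y ^ n)‖ ≤ M * (n * M ^ n * ‖x - y‖) :=
      (norm_mul_le _ _).trans (mul_le_mul hx ih (norm_nonneg _) (by linarith))
    have h2 : ‖(x - y) * y ^ n‖ ≤ ‖x - y‖ * M ^ (n + 1) := by
      refine (norm_mul_le _ _).trans (mul_le_mul_of_nonneg_left ?_ (norm_nonneg _))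
      calc ‖y ^ n‖ ≤ ‖y‖ ^ n := norm_pow_le _ _
        _ ≤ M ^ n := by gcongr
        _ ≤ M ^ (n + 1) := pow_le_pow_right₀ hM (Nat.le_succ n)
    rw [e]
    refine (norm_add_le _ _).trans ((add_le_add h1 h2).trans (le_of_eq ?_))
    push_cast; ring

lemma eventually_norm_le_one_add [NormedSpace ℝ 𝔸] {f : ℝ → 𝔸} {f' : 𝔸}
    (hf : HasDerivAt f f' 0) (hf0 : f 0 = 1) :
    ∀ᶠ s in 𝓝 (0 : ℝ), ‖f s‖ ≤ 1 + (‖f'‖ + 1) * |s| := by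
  have h := (hasDerivAt_iff_isLittleO.mp hf).bound one_pos
  filter_upwards [h] with s hs
  rw [hf0, sub_zero, one_mul, Real.norm_eq_abs] at hs
  have e : f s = (f s - 1 - s • f') + 1 + s • f' := by abel
  rw [e]
  refine (norm_add_le _ _).trans ((add_le_add (norm_add_le _ _) le_rfl).trans ?_)
  rw [norm_one, norm_smul, Real.norm_eq_abs]
  linarith

/-- Two curves through `1` with the same velocity at `0` have asymptotically equal
`N`-th powers at time `1 / N`. -/
lemma tendsto_pow_sub_pow [NormedSpace ℝ 𝔸] {f g : ℝ → 𝔸} {f' : 𝔸}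
    (hf : HasDerivAt f f' 0) (hg : HasDerivAt g f' 0) (hf0 : f 0 = 1) (hg0 : g 0 = 1) :
    Tendsto (fun N : ℕ => f (1 / (N : ℝ)) ^ N - g (1 / (N : ℝ)) ^ N) atTop (𝓝 0) := by
  have ht : Tendsto (fun N : ℕ => 1 / (N : ℝ)) atTop (𝓝 0) := tendsto_one_div_atTop_nhds_zero_nat
  set K := ‖f'‖ + 1
  have hK : 0 ≤ K := by positivity
  rw [Metric.tendsto_atTop']
  intro δ hδ
  have hd := hasDerivAt_iff_isLittleO.mp (hf.sub hg)
  -- The two factors differ by o(1/N) while their N-th powers stay below e^K. With this multiple of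
  -- 1/N as the bound on the difference, telescoping gives exactly δ/2.
  have hc : 0 < δ / (2 * Real.exp K) := by positivity
  obtain ⟨N₀, hN₀⟩ := eventually_atTop.mp
    ((ht.eventually (eventually_norm_le_one_add hf hf0)).and
    ((ht.eventually (eventually_norm_le_one_add hg hg0)).and (ht.eventually (hd.bound hc))))
  refine ⟨max N₀ 1, fun N hN => ?_⟩
  obtain ⟨h1, h2, h3⟩ := hN₀ N (le_of_lt (lt_of_le_of_lt (le_max_left _ _) hN))
  have hN1 : (0 : ℝ) < N := by
    exact_mod_cast lt_trans zero_lt_one (lt_of_le_of_lt (le_max_right _ _) hN)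
  have habs : |1 / (N : ℝ)| = 1 / N := abs_of_pos (by positivity)
  simp only [Pi.sub_apply, sub_self, smul_zero, sub_zero, hf0, hg0, Real.norm_eq_abs, habs] at h1 h2 h3
  have hM : 1 ≤ 1 + K * (1 / (N : ℝ)) := by
    have : 0 ≤ K * (1 / (N : ℝ)) := by positivity
    linarith
  have hpow : (1 + K * (1 / (N : ℝ))) ^ N ≤ Real.exp K := by
    calc (1 + K * (1 / (N : ℝ))) ^ N ≤ Real.exp (K * (1 / N)) ^ N := by
          gcongr
          rw [add_comm]; exact Real.add_one_le_exp _
      _ = Real.exp K := by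
          rw [← Real.exp_nat_mul]; congr 1; field_simp
  rw [dist_zero_right]
  calc _ ≤ N * (1 + K * (1 / (N : ℝ))) ^ N * ‖f (1 / (N : ℝ)) - g (1 / (N : ℝ))‖ :=
        norm_pow_sub_pow_le hM h1 h2 N
    _ ≤ N * Real.exp K * (δ / (2 * Real.exp K) * (1 / N)) := by gcongr
    _ = δ / 2 := by field_simp
    _ < δ := by linarith

/-- The Lie–Trotter product formula. -/
lemma tendsto_exp_mul_exp_pow [NormedAlgebra ℝ 𝔸] [CompleteSpace 𝔸] (A B : 𝔸) :
    Tendsto (fun N : ℕ => (NormedSpace.exp ((1 / (N : ℝ)) • A)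
      * NormedSpace.exp ((1 / (N : ℝ)) • B)) ^ N) atTop (𝓝 (NormedSpace.exp (A + B))) := by
  have h (C : 𝔸) : HasDerivAt (fun s : ℝ => NormedSpace.exp (s • C)) C 0 := by
    simpa using hasDerivAt_exp_smul_const (𝕂 := ℝ) C 0
  have hf : HasDerivAt (fun s : ℝ => NormedSpace.exp (s • A) * NormedSpace.exp (s • B)) (A + B) 0 := by
    have := (h A).mul (h B)
    simp only [zero_smul, NormedSpace.exp_zero, mul_one, one_mul] at this
    exact this
  have key := tendsto_pow_sub_pow hf (h (A + B)) (by simp) (by simp)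
  have h2 : Tendsto (fun N : ℕ => NormedSpace.exp ((1 / (N : ℝ)) • (A + B)) ^ N) atTop
      (𝓝 (NormedSpace.exp (A + B))) := by
    refine tendsto_const_nhds.congr' ?_
    filter_upwards [eventually_gt_atTop 0] with N hN
    let _ : NormedAlgebra ℚ 𝔸 := NormedAlgebra.restrictScalars ℚ ℝ 𝔸
    rw [← NormedSpace.exp_nsmul, ← Nat.cast_smul_eq_nsmul ℝ, smul_smul]
    have : (N : ℝ) ≠ 0 := by positivity
    rw [mul_one_div_cancel this, one_smul]
  simpa using key.add h2

end LieTrotter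

/-! ### Trace inequalities for dyadic powers and the Golden–Thompson inequality. -/

section GoldenThompson

open Matrix Filter Topology

variable {ι : Type*} [Fintype ι]

lemma trace_transpose_mul_eq_sum {κ : Type*} [Fintype κ] (X Y : Matrix ι κ ℝ) :
    (Xᵀ * Y).trace = ∑ i, ∑ j, X i j * Y i j := by
  simp only [trace, diag, mul_apply, transpose_apply]
  exact Finset.sum_comm

lemma trace_transpose_mul_self_nonneg {κ : Type*} [Fintype κ] (X : Matrix ι κ ℝ) :
    0 ≤ (Xᵀ * X).trace := by
  rw [trace_transpose_mul_eq_sum]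
  exact Finset.sum_nonneg fun i _ => Finset.sum_nonneg fun j _ => mul_self_nonneg _

lemma two_mul_abs_trace_transpose_mul_le {κ : Type*} [Fintype κ] (X Y : Matrix ι κ ℝ) :
    2 * |(Xᵀ * Y).trace| ≤ (Xᵀ * X).trace + (Yᵀ * Y).trace := by
  have h1 := trace_transpose_mul_self_nonneg (X - Y)
  have h2 := trace_transpose_mul_self_nonneg (X + Y)
  have h3 : (Yᵀ * X).trace = (Xᵀ * Y).trace := by
    rw [← trace_transpose, transpose_mul, transpose_transpose]
  simp only [transpose_sub, transpose_add, Matrix.sub_mul, Matrix.mul_sub, Matrix.add_mul,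
    Matrix.mul_add, trace_sub, trace_add, h3] at h1 h2
  rcases abs_cases (Xᵀ * Y).trace with ⟨h, _⟩ | ⟨h, _⟩ <;> rw [h] <;> linarith

variable [DecidableEq ι]

lemma trace_mul_pow_comm (A B : Matrix ι ι ℝ) (k : ℕ) :
    ((A * B) ^ k).trace = ((B * A) ^ k).trace := by
  cases k with
  | zero => simp
  | succ k =>
    have : (A * B) ^ (k + 1) = A * ((B * A) ^ k * B) := by
      induction k with
      | zero => simp
      | succ k ih => rw [pow_succ', ih, pow_succ']; simp only [Matrix.mul_assoc]
    rw [this, trace_mul_comm, pow_succ, Matrix.mul_assoc]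

lemma isSymm_pow {A : Matrix ι ι ℝ} (hA : A.IsSymm) (k : ℕ) : (A ^ k).IsSymm := by
  rw [IsSymm, transpose_pow, hA.eq]

/-- Weyl-type trace inequality for dyadic powers, jointly with its consequence for products of
symmetric matrices. -/
lemma abs_trace_pow_two_pow_le (k : ℕ) :
    (∀ X : Matrix ι ι ℝ, |(X ^ 2 ^ (k + 1)).trace| ≤ ((Xᵀ * X) ^ 2 ^ k).trace) ∧
    (∀ A B : Matrix ι ι ℝ, A.IsSymm → B.IsSymm →
      |((A * B) ^ 2 ^ k).trace| ≤ |(A ^ 2 ^ k * B ^ 2 ^ k).trace|) := by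
  induction k with
  | zero =>
    refine ⟨fun X => ?_, fun A B _ _ => by simp⟩
    have h := two_mul_abs_trace_transpose_mul_le Xᵀ X
    rw [transpose_transpose, trace_mul_comm X Xᵀ] at h
    simp only [zero_add, pow_one, pow_zero, sq]
    linarith
  | succ k ih =>
    obtain ⟨ihG, ihH⟩ := ih
    constructor
    -- Apply the first induction hypothesis to X², regroup cyclically into a power of (XᵀX)(XXᵀ),
    -- and separate the two symmetric factors by the second hypothesis. The arithmetic–geometric
    -- mean inequality finishes, since XᵀX and XXᵀ have powers of equal trace.
    · intro X
      have hP : (Xᵀ * X).IsSymm := by simp [IsSymm]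
      have hQ : (X * Xᵀ).IsSymm := by simp [IsSymm]
      have e1 : (((X ^ 2)ᵀ * X ^ 2) ^ 2 ^ k).trace = (((Xᵀ * X) * (X * Xᵀ)) ^ 2 ^ k).trace := by
        rw [sq, transpose_mul, show Xᵀ * Xᵀ * (X * X) = Xᵀ * (Xᵀ * X * X) by
          simp only [Matrix.mul_assoc], trace_mul_pow_comm]
        simp only [Matrix.mul_assoc]
      have h1 := ihG (X ^ 2)
      rw [← pow_mul, ← pow_succ', e1] at h1
      have h2 := (le_abs_self _).trans (ihH _ _ hP hQ)
      have h3 := two_mul_abs_trace_transpose_mul_le ((Xᵀ * X) ^ 2 ^ k) ((X * Xᵀ) ^ 2 ^ k)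
      rw [(isSymm_pow hP _).eq, (isSymm_pow hQ _).eq, ← pow_add, ← pow_add,
        trace_mul_pow_comm X, ← two_mul (2 ^ k), ← pow_succ'] at h3
      linarith
    -- The first hypothesis for X = AB produces, up to cyclic order, a power of A²B², to which the
    -- second applies.
    · intro A B hA hB
      have h1 := ihG (A * B)
      rw [transpose_mul, hA.eq, hB.eq, show B * A * (A * B) = B * (A * A * B) by
        simp only [Matrix.mul_assoc], trace_mul_pow_comm B, Matrix.mul_assoc (A * A) B B] at h1
      have h2 := ihH (A * A) (B * B) (by simp [IsSymm, hA.eq]) (by simp [IsSymm, hB.eq])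
      rw [← sq, ← sq, ← pow_mul, ← pow_mul, ← pow_succ'] at h2
      rw [← sq, ← sq] at h1
      exact h1.trans ((le_abs_self _).trans h2)

attribute [local instance] Matrix.linftyOpNormedRing Matrix.linftyOpNormedAlgebra
  Matrix.linfty_opNormOneClass in
/-- The Golden–Thompson inequality with an absolute value on the right-hand side. -/
theorem trace_exp_add_le_abs {A B : Matrix ι ι ℝ} (hA : A.IsSymm) (hB : B.IsSymm) :
    (NormedSpace.exp (A + B)).trace ≤ |(NormedSpace.exp A * NormedSpace.exp B).trace| := by
  -- The auxiliary operator norm satisfies ‖1‖ = 1 only for a nonempty index set. Afterwards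
  -- Lie–Trotter is used along N = 2^k, where the dyadic trace inequality is available.
  rcases isEmpty_or_nonempty ι with hι | hι
  · simp [trace]
  have h := (tendsto_exp_mul_exp_pow A B).comp (tendsto_pow_atTop_atTop_of_one_lt one_lt_two)
  have hc : Continuous (fun M : Matrix ι ι ℝ => M.trace) := continuous_id.matrix_trace
  refine le_of_tendsto ((hc.tendsto _).comp h) (Eventually.of_forall fun k => ?_)
  have hs {M : Matrix ι ι ℝ} (hM : M.IsSymm) (a : ℝ) : (NormedSpace.exp (a • M)).IsSymm :=
    IsSymm.exp (hM.smul a)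
  have hp (M : Matrix ι ι ℝ) :
      NormedSpace.exp ((1 / ((2 ^ k : ℕ) : ℝ)) • M) ^ 2 ^ k = NormedSpace.exp M := by
    rw [← Matrix.exp_nsmul, ← Nat.cast_smul_eq_nsmul ℝ, smul_smul, mul_one_div_cancel (by positivity),
      one_smul]
  have := (abs_trace_pow_two_pow_le k).2 _ _ (hs hA (1 / ((2 ^ k : ℕ) : ℝ)))
    (hs hB (1 / ((2 ^ k : ℕ) : ℝ)))
  rw [hp, hp] at this
  exact (le_abs_self _).trans this

end GoldenThompson

/-! ### Exponentials of symmetric matrices through their eigenvalues. -/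

section TraceExp

open Matrix

variable {ι : Type*} [Fintype ι] [DecidableEq ι]

/-- The spectral theorem for real symmetric matrices, in coordinates. -/
lemma exists_orthogonal_diagonalization {S : Matrix ι ι ℝ} (hS : S.IsSymm) :
    ∃ (U : Matrix ι ι ℝ) (d : ι → ℝ), Uᵀ * U = 1 ∧ U * Uᵀ = 1 ∧ S = U * diagonal d * Uᵀ := by
  have hH : S.IsHermitian := by rw [IsHermitian, conjTranspose_eq_transpose_of_trivial]; exact hS
  refine ⟨hH.eigenvectorUnitary, hH.eigenvalues, ?_, ?_, ?_⟩
  · rw [← conjTranspose_eq_transpose_of_trivial, ← star_eq_conjTranspose]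
    exact Unitary.coe_star_mul_self _
  · rw [← conjTranspose_eq_transpose_of_trivial, ← star_eq_conjTranspose]
    exact Unitary.coe_mul_star_self _
  · conv_lhs => rw [hH.spectral_theorem]
    rw [Unitary.conjStarAlgAut_apply, star_eq_conjTranspose, conjTranspose_eq_transpose_of_trivial]
    rfl

lemma exp_conj_diagonal {U : Matrix ι ι ℝ} {d : ι → ℝ} (h1 : Uᵀ * U = 1) (h2 : U * Uᵀ = 1) :
    NormedSpace.exp (U * diagonal d * Uᵀ) = U * diagonal (fun i => Real.exp (d i)) * Uᵀ := by
  have hU : IsUnit U := ⟨⟨U, Uᵀ, h2, h1⟩, rfl⟩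
  have hi : U⁻¹ = Uᵀ := inv_eq_left_inv h1
  rw [← hi, exp_conj _ _ hU, exp_diagonal]
  congr 2
  ext i j
  simp only [diagonal, of_apply, Pi.coe_exp, Real.exp_eq_exp_ℝ]

lemma mul_diagonal_mul_transpose_mulVec (U : Matrix ι ι ℝ) (d x : ι → ℝ) :
    x ⬝ᵥ (U * diagonal d * Uᵀ) *ᵥ x = ∑ i, d i * (Uᵀ *ᵥ x) i ^ 2 := by
  rw [← mulVec_mulVec, ← mulVec_mulVec, dotProduct_mulVec, ← mulVec_transpose, dotProduct]
  refine Finset.sum_congr rfl fun i _ => ?_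
  rw [mulVec_diagonal]; ring

lemma sum_transpose_mulVec_sq {U : Matrix ι ι ℝ} (h : U * Uᵀ = 1) (x : ι → ℝ) :
    ∑ i, (Uᵀ *ᵥ x) i ^ 2 = x ⬝ᵥ x := by
  have := mul_diagonal_mul_transpose_mulVec U (fun _ => 1) x
  simpa [h] using this.symm

lemma col_mulVec_diagonalization {U : Matrix ι ι ℝ} {d : ι → ℝ} (h : Uᵀ * U = 1) (i : ι) :
    (U *ᵥ Pi.single i 1) ⬝ᵥ (U * diagonal d * Uᵀ) *ᵥ (U *ᵥ Pi.single i 1) = d i := by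
  rw [mul_diagonal_mul_transpose_mulVec, mulVec_mulVec, h, one_mulVec]
  simp [Pi.single_apply]

lemma col_dotProduct_self {U : Matrix ι ι ℝ} (h : Uᵀ * U = 1) (i : ι) :
    (U *ᵥ Pi.single i 1) ⬝ᵥ (U *ᵥ Pi.single i 1) = 1 := by
  rw [dotProduct_mulVec, ← mulVec_transpose, mulVec_mulVec, h, one_mulVec]
  simp

lemma posSemidef_conj_diagonal (U : Matrix ι ι ℝ) {d : ι → ℝ} (hd : ∀ i, 0 ≤ d i) :
    (U * diagonal d * Uᵀ).PosSemidef := by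
  have := (PosSemidef.diagonal hd).mul_mul_conjTranspose_same U
  rwa [conjTranspose_eq_transpose_of_trivial] at this

lemma exp_eq_transpose_mul_self {A : Matrix ι ι ℝ} (hA : A.IsSymm) :
    ∃ X : Matrix ι ι ℝ, X.IsSymm ∧ NormedSpace.exp A = X * X := by
  refine ⟨NormedSpace.exp ((1 / 2 : ℝ) • A), IsSymm.exp (hA.smul _), ?_⟩
  rw [← Matrix.exp_add_of_commute _ _ (Commute.refl _), ← add_smul]
  norm_num

/-- With e^A = X² and X symmetric, the trace equals that of XMX. This removes the absolute value
from Golden–Thompson. -/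
lemma trace_exp_mul_nonneg {A M : Matrix ι ι ℝ} (hA : A.IsSymm) (hM : M.PosSemidef) :
    0 ≤ (NormedSpace.exp A * M).trace := by
  obtain ⟨X, hX, e⟩ := exp_eq_transpose_mul_self hA
  have := (hM.mul_mul_conjTranspose_same X).trace_nonneg
  rw [conjTranspose_eq_transpose_of_trivial, hX.eq, trace_mul_comm, ← Matrix.mul_assoc, ← e] at this
  exact this

lemma posSemidef_exp {A : Matrix ι ι ℝ} (hA : A.IsSymm) : (NormedSpace.exp A).PosSemidef := by
  obtain ⟨X, hX, e⟩ := exp_eq_transpose_mul_self hA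
  have := posSemidef_conjTranspose_mul_self X
  rwa [conjTranspose_eq_transpose_of_trivial, hX.eq, ← e] at this

/-- The **Golden–Thompson inequality** for real symmetric matrices. -/
theorem trace_exp_add_le {A B : Matrix ι ι ℝ} (hA : A.IsSymm) (hB : B.IsSymm) :
    (NormedSpace.exp (A + B)).trace ≤ (NormedSpace.exp A * NormedSpace.exp B).trace := by
  have := trace_exp_add_le_abs hA hB
  rwa [abs_of_nonneg (trace_exp_mul_nonneg hA (posSemidef_exp hB))] at this

/-- If the quadratic form exceeds y somewhere, some eigenvalue does, and its exponential is one of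
the positive summands of the trace. This is the exponential Markov step for the largest eigenvalue.
-/
lemma exp_le_trace_exp {H : Matrix ι ι ℝ} (hH : H.IsSymm) {y : ℝ}
    (h : ¬ ∀ x : ι → ℝ, x ⬝ᵥ H *ᵥ x ≤ y * (x ⬝ᵥ x)) :
    Real.exp y ≤ (NormedSpace.exp H).trace := by
  obtain ⟨U, d, h1, h2, rfl⟩ := exists_orthogonal_diagonalization hH
  have : ∃ i, y < d i := by
    by_contra! hd
    refine h fun x => ?_
    rw [mul_diagonal_mul_transpose_mulVec, ← sum_transpose_mulVec_sq h2, Finset.mul_sum]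
    exact Finset.sum_le_sum fun i _ => mul_le_mul_of_nonneg_right (hd i) (sq_nonneg _)
  obtain ⟨i, hi⟩ := this
  rw [exp_conj_diagonal h1 h2, trace_mul_comm, ← Matrix.mul_assoc, h1, Matrix.one_mul, trace_diagonal]
  exact (Real.exp_le_exp.mpr hi.le).trans
    (Finset.single_le_sum (f := fun i => Real.exp (d i)) (fun j _ => (Real.exp_pos _).le)
      (Finset.mem_univ i))

/-- The power series of (e^x - 1 - x)/x² has nonnegative coefficients, so termwise comparison bounds
it on [-a, a] by its value at a. -/
lemma exp_sub_one_sub_le {a x : ℝ} (ha : 0 < a) (hx : |x| ≤ a) :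
    Real.exp x ≤ 1 + x + (Real.exp a - 1 - a) / a ^ 2 * x ^ 2 := by
  have hs (z : ℝ) : HasSum (fun k : ℕ => z ^ (k + 2) / (k + 2).factorial) (Real.exp z - 1 - z) := by
    have h : HasSum (fun k : ℕ => z ^ k / k.factorial) (Real.exp z) := by
      rw [Real.exp_eq_exp_ℝ]; exact NormedSpace.expSeries_div_hasSum_exp z
    have := (hasSum_nat_add_iff' 2).mpr h
    simpa [Finset.sum_range_succ, sub_sub] using this
  have h := hasSum_le (fun k : ℕ => ?_) (hs x) ((hs a).mul_left (x ^ 2 / a ^ 2))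
  · have e : (Real.exp a - 1 - a) / a ^ 2 * x ^ 2 = x ^ 2 / a ^ 2 * (Real.exp a - 1 - a) := by ring
    rw [e]; linarith
  · have e : x ^ 2 / a ^ 2 * (a ^ (k + 2) / (k + 2).factorial)
        = x ^ 2 * a ^ k / (k + 2).factorial := by
      rw [pow_add]; field_simp
    have hk : x ^ k ≤ a ^ k := (le_abs_self _).trans (by rw [abs_pow]; gcongr)
    rw [e, pow_add, mul_comm (x ^ k)]
    exact div_le_div_of_nonneg_right (mul_le_mul_of_nonneg_left hk (sq_nonneg x)) (by positivity)

lemma posSemidef_one_add_add_smul_sub_exp {H : Matrix ι ι ℝ} (hH : H.IsSymm) {a : ℝ} (ha : 0 < a)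
    (h : ∀ x : ι → ℝ, |x ⬝ᵥ H *ᵥ x| ≤ a * (x ⬝ᵥ x)) :
    (1 + H + ((Real.exp a - 1 - a) / a ^ 2) • (H * H) - NormedSpace.exp H).PosSemidef := by
  obtain ⟨U, d, h1, h2, rfl⟩ := exists_orthogonal_diagonalization hH
  have hd (i : ι) : |d i| ≤ a := by
    have := h (U *ᵥ Pi.single i 1)
    rwa [col_mulVec_diagonalization h1, col_dotProduct_self h1, mul_one] at this
  set ψ := (Real.exp a - 1 - a) / a ^ 2
  have e : 1 + U * diagonal d * Uᵀ + ψ • (U * diagonal d * Uᵀ * (U * diagonal d * Uᵀ))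
      - NormedSpace.exp (U * diagonal d * Uᵀ)
      = U * diagonal (fun i => 1 + d i + ψ * d i ^ 2 - Real.exp (d i)) * Uᵀ := by
    have e1 : U * diagonal d * Uᵀ * (U * diagonal d * Uᵀ) = U * diagonal (fun i => d i ^ 2) * Uᵀ := by
      rw [show U * diagonal d * Uᵀ * (U * diagonal d * Uᵀ)
        = U * diagonal d * (Uᵀ * U) * (diagonal d * Uᵀ) by simp only [Matrix.mul_assoc], h1,
        Matrix.mul_one, ← Matrix.mul_assoc, Matrix.mul_assoc U, diagonal_mul_diagonal]
      simp only [sq]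
    have e2 : diagonal (fun i => 1 + d i + ψ * d i ^ 2 - Real.exp (d i))
        = 1 + diagonal d + ψ • diagonal (fun i => d i ^ 2) - diagonal (fun i => Real.exp (d i)) := by
      ext i j
      by_cases hij : i = j
      · subst hij; simp
      · simp [hij]
    rw [exp_conj_diagonal h1 h2, e1, e2]
    simp only [Matrix.mul_sub, Matrix.sub_mul, Matrix.mul_add, Matrix.add_mul, Matrix.mul_one, h2,
      Matrix.mul_smul, Matrix.smul_mul]
  rw [e]
  refine posSemidef_conj_diagonal U fun i => ?_
  have := exp_sub_one_sub_le ha (hd i)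
  linarith

end TraceExp

/-! ### The matrix Bernstein inequality on a finite probability space. -/

section Bernstein

open Matrix

variable {T : Type*} [Fintype T] {p : T → ℝ}

lemma posSemidef_of_forall {ι : Type*} [Fintype ι] {M : Matrix ι ι ℝ} (hM : M.IsSymm) (h : ∀ x, 0 ≤ x ⬝ᵥ M *ᵥ x) :
    M.PosSemidef := by
  refine posSemidef_iff_dotProduct_mulVec.mpr ⟨?_, fun x => ?_⟩
  · rw [IsHermitian, conjTranspose_eq_transpose_of_trivial]; exact hM
  · simpa using h x

lemma dotProduct_mulVec_nonneg_real {ι : Type*} [Fintype ι] {M : Matrix ι ι ℝ} (h : M.PosSemidef) (x : ι → ℝ) :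
    0 ≤ x ⬝ᵥ M *ᵥ x := by
  simpa using h.dotProduct_mulVec_nonneg x

section Symmetric

variable {ι : Type*} [Fintype ι] [DecidableEq ι]

/-- The Ahlswede–Winter iteration: Golden–Thompson detaches one observation, whose averaged
exponential is dominated by K times the identity. The shift A absorbs the detached term, so the
induction has to run over all A. -/
lemma sum_prod_mul_trace_exp_le (hp : ∀ t, 0 ≤ p t) {H : T → Matrix ι ι ℝ}
    (hH : ∀ t, (H t).IsSymm) {K : ℝ} (hK0 : 0 ≤ K)
    (hK : (K • 1 - ∑ t, p t • NormedSpace.exp (H t)).PosSemidef) (n : ℕ) {A : Matrix ι ι ℝ}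
    (hA : A.IsSymm) :
    ∑ x : Fin n → T, (∏ j, p (x j)) * (NormedSpace.exp (A + ∑ j, H (x j))).trace
      ≤ K ^ n * (NormedSpace.exp A).trace := by
  induction n generalizing A with
  | zero => simp
  | succ n ih =>
    rw [← (Fin.consEquiv fun _ => T).sum_comp, Fintype.sum_prod_type]
    simp only [Fin.consEquiv_apply, Fin.prod_univ_succ, Fin.sum_univ_succ, Fin.cons_zero,
      Fin.cons_succ]
    calc _ = ∑ t, p t * ∑ x : Fin n → T, (∏ j, p (x j))
            * (NormedSpace.exp ((A + H t) + ∑ j, H (x j))).trace := by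
          simp only [Finset.mul_sum, mul_assoc, add_assoc]
      _ ≤ ∑ t, p t * (K ^ n * (NormedSpace.exp A * NormedSpace.exp (H t)).trace) := by
          refine Finset.sum_le_sum fun t _ => mul_le_mul_of_nonneg_left ?_ (hp t)
          exact (ih (hA.add (hH t))).trans
            (mul_le_mul_of_nonneg_left (trace_exp_add_le hA (hH t)) (by positivity))
      _ = K ^ n * (NormedSpace.exp A * ∑ t, p t • NormedSpace.exp (H t)).trace := by
          rw [Matrix.mul_sum, trace_sum, Finset.mul_sum]
          refine Finset.sum_congr rfl fun t _ => ?_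
          rw [Matrix.mul_smul, trace_smul, smul_eq_mul]; ring
      _ ≤ K ^ n * (K * (NormedSpace.exp A).trace) := by
          gcongr
          have := trace_exp_mul_nonneg hA hK
          rw [Matrix.mul_sub, trace_sub, Matrix.mul_smul, Matrix.mul_one, trace_smul, smul_eq_mul] at this
          linarith
      _ = _ := by ring

/-- The matrix moment generating function bound behind the Bernstein inequality. -/
lemma posSemidef_smul_one_sub_sum_exp (hp : ∀ t, 0 ≤ p t) (hp1 : ∑ t, p t = 1)
    {D : T → Matrix ι ι ℝ} (hD : ∀ t, (D t).IsSymm) (hD0 : ∑ t, p t • D t = 0) {R σ θ a : ℝ}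
    (hR : ∀ t x, |x ⬝ᵥ D t *ᵥ x| ≤ R * (x ⬝ᵥ x))
    (hσ : ∀ x, ∑ t, p t * (D t *ᵥ x ⬝ᵥ D t *ᵥ x) ≤ σ * (x ⬝ᵥ x))
    (hθ : 0 ≤ θ) (ha : 0 < a) (hθR : θ * R ≤ a) :
    (Real.exp ((Real.exp a - 1 - a) / a ^ 2 * θ ^ 2 * σ) • 1
      - ∑ t, p t • NormedSpace.exp (θ • D t)).PosSemidef := by
  set ψ := (Real.exp a - 1 - a) / a ^ 2 with hψ
  have hψ0 : 0 ≤ ψ := by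
    have := Real.add_one_le_exp a
    exact div_nonneg (by linarith) (by positivity)
  refine posSemidef_of_forall ?_ fun x => ?_
  · refine (isSymm_one.smul _).sub ?_
    rw [IsSymm, transpose_sum]
    refine Finset.sum_congr rfl fun t _ => ?_
    rw [transpose_smul, (IsSymm.exp ((hD t).smul θ)).eq]
  have hx : 0 ≤ x ⬝ᵥ x := by simpa using dotProduct_star_self_nonneg x
  have h1 (t : T) : x ⬝ᵥ NormedSpace.exp (θ • D t) *ᵥ x
      ≤ x ⬝ᵥ x + θ * (x ⬝ᵥ D t *ᵥ x) + ψ * θ ^ 2 * (D t *ᵥ x ⬝ᵥ D t *ᵥ x) := by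
    have h := dotProduct_mulVec_nonneg_real
      (posSemidef_one_add_add_smul_sub_exp ((hD t).smul θ) ha fun x => by
      rw [smul_mulVec, dotProduct_smul, smul_eq_mul, abs_mul, abs_of_nonneg hθ]
      calc θ * |x ⬝ᵥ D t *ᵥ x| ≤ θ * (R * (x ⬝ᵥ x)) := by gcongr; exact hR t x
        _ = θ * R * (x ⬝ᵥ x) := by ring
        _ ≤ a * (x ⬝ᵥ x) := by
            gcongr
            simpa using dotProduct_star_self_nonneg x) x
    have e : x ⬝ᵥ (D t * D t) *ᵥ x = D t *ᵥ x ⬝ᵥ D t *ᵥ x := by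
      rw [← mulVec_mulVec, dotProduct_mulVec, ← mulVec_transpose, (hD t).eq]
    simp only [sub_mulVec, add_mulVec, one_mulVec, smul_mulVec, Matrix.smul_mul, Matrix.mul_smul,
      dotProduct_sub, dotProduct_add, dotProduct_smul, smul_eq_mul, e] at h
    rw [← hψ] at h
    linarith
  have h0 : ∑ t, p t * (x ⬝ᵥ D t *ᵥ x) = 0 := by
    have := congrArg (fun M => x ⬝ᵥ M *ᵥ x) hD0
    simpa [sum_mulVec, dotProduct_sum, smul_mulVec] using this
  have h2 : ∑ t, p t * (x ⬝ᵥ NormedSpace.exp (θ • D t) *ᵥ x)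
      ≤ (1 + ψ * θ ^ 2 * σ) * (x ⬝ᵥ x) := by
    calc _ ≤ ∑ t, p t * (x ⬝ᵥ x + θ * (x ⬝ᵥ D t *ᵥ x)
            + ψ * θ ^ 2 * (D t *ᵥ x ⬝ᵥ D t *ᵥ x)) :=
          Finset.sum_le_sum fun t _ => mul_le_mul_of_nonneg_left (h1 t) (hp t)
      _ = (∑ t, p t) * (x ⬝ᵥ x) + θ * ∑ t, p t * (x ⬝ᵥ D t *ᵥ x)
            + ψ * θ ^ 2 * ∑ t, p t * (D t *ᵥ x ⬝ᵥ D t *ᵥ x) := by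
          rw [Finset.sum_mul, Finset.mul_sum, Finset.mul_sum, ← Finset.sum_add_distrib,
            ← Finset.sum_add_distrib]
          exact Finset.sum_congr rfl fun t _ => by ring
      _ ≤ 1 * (x ⬝ᵥ x) + θ * 0 + ψ * θ ^ 2 * (σ * (x ⬝ᵥ x)) := by
          rw [hp1, h0]; gcongr; exact hσ x
      _ = _ := by ring
  have h3 : (1 + ψ * θ ^ 2 * σ) * (x ⬝ᵥ x) ≤ Real.exp (ψ * θ ^ 2 * σ) * (x ⬝ᵥ x) := by
    gcongr
    rw [add_comm]; exact Real.add_one_le_exp _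
  simp only [sub_mulVec, sum_mulVec, smul_mulVec, one_mulVec, dotProduct_sub, dotProduct_sum,
    dotProduct_smul, smul_eq_mul]
  linarith

open Classical in
-- Markov's inequality for the trace of the exponential. Both θ and a stay free because the operator
-- norm and the Frobenius norm bounds tune them differently.
lemma sum_prod_filter_le_symm (hp : ∀ t, 0 ≤ p t) (hp1 : ∑ t, p t = 1)
    {D : T → Matrix ι ι ℝ} (hD : ∀ t, (D t).IsSymm) (hD0 : ∑ t, p t • D t = 0) {R σ θ a : ℝ}
    (hR : ∀ t x, |x ⬝ᵥ D t *ᵥ x| ≤ R * (x ⬝ᵥ x))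
    (hσ : ∀ x, ∑ t, p t * (D t *ᵥ x ⬝ᵥ D t *ᵥ x) ≤ σ * (x ⬝ᵥ x))
    (hθ : 0 < θ) (ha : 0 < a) (hθR : θ * R ≤ a) (n : ℕ) (y : ℝ) :
    ∑ x : Fin n → T with ¬ ∀ v, v ⬝ᵥ (∑ j, D (x j)) *ᵥ v ≤ y * (v ⬝ᵥ v), ∏ j, p (x j)
      ≤ Fintype.card ι
        * Real.exp (n * ((Real.exp a - 1 - a) / a ^ 2 * θ ^ 2 * σ) - θ * y) := by
  set g := (Real.exp a - 1 - a) / a ^ 2 * θ ^ 2 * σ with hg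
  have hpp (x : Fin n → T) : 0 ≤ ∏ j, p (x j) := Finset.prod_nonneg fun j _ => hp _
  have hsum (x : Fin n → T) : ∑ j, θ • D (x j) = θ • ∑ j, D (x j) := by rw [Finset.smul_sum]
  have hsym (x : Fin n → T) : (θ • ∑ j, D (x j)).IsSymm := by
    refine IsSymm.smul ?_ θ
    rw [IsSymm, transpose_sum]
    exact Finset.sum_congr rfl fun j _ => (hD _).eq
  have hexp (x : Fin n → T) (hx : ¬ ∀ v, v ⬝ᵥ (∑ j, D (x j)) *ᵥ v ≤ y * (v ⬝ᵥ v)) :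
      Real.exp (θ * y) ≤ (NormedSpace.exp (θ • ∑ j, D (x j))).trace := by
    refine exp_le_trace_exp (hsym x) fun hall => hx fun v => ?_
    have := hall v
    rw [smul_mulVec, dotProduct_smul, smul_eq_mul, mul_assoc] at this
    exact le_of_mul_le_mul_left this hθ
  have h := sum_prod_mul_trace_exp_le hp (fun t => (hD t).smul θ) (Real.exp_pos g).le
    (posSemidef_smul_one_sub_sum_exp hp hp1 hD hD0 hR hσ hθ.le ha hθR) n
    (A := 0) isSymm_zero
  simp only [zero_add, hsum, NormedSpace.exp_zero, trace_one] at h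
  have h2 : (∑ x : Fin n → T with ¬ ∀ v, v ⬝ᵥ (∑ j, D (x j)) *ᵥ v ≤ y * (v ⬝ᵥ v), ∏ j, p (x j))
      * Real.exp (θ * y) ≤ Real.exp g ^ n * Fintype.card ι := by
    refine le_trans ?_ h
    rw [Finset.sum_mul]
    refine (Finset.sum_le_sum fun x hx => mul_le_mul_of_nonneg_left (hexp x ?_) (hpp x)).trans
      (Finset.sum_le_sum_of_subset_of_nonneg (Finset.filter_subset _ _) fun x _ _ =>
        mul_nonneg (hpp x) (posSemidef_exp (hsym x)).trace_nonneg)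
    exact (Finset.mem_filter.mp hx).2
  rw [Real.exp_sub, ← mul_div_assoc, le_div_iff₀ (Real.exp_pos _), Real.exp_nat_mul, mul_comm (Fintype.card ι : ℝ)]
  exact h2

end Symmetric

section Rectangular

variable {ι κ : Type*}

/-- The self-adjoint dilation of a rectangular matrix. -/
def dilation (Z : Matrix ι κ ℝ) : Matrix (ι ⊕ κ) (ι ⊕ κ) ℝ := fromBlocks 0 Z Zᵀ 0

lemma dilation_isSymm (Z : Matrix ι κ ℝ) : (dilation Z).IsSymm := by
  simp [IsSymm, dilation, fromBlocks_transpose]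

variable [Fintype ι] [Fintype κ]

lemma dilation_mulVec (Z : Matrix ι κ ℝ) (x : ι ⊕ κ → ℝ) :
    dilation Z *ᵥ x = Sum.elim (Z *ᵥ (x ∘ Sum.inr)) (Zᵀ *ᵥ (x ∘ Sum.inl)) := by
  simp [dilation, fromBlocks_mulVec]

lemma dotProduct_sum_split (x y : ι ⊕ κ → ℝ) :
    x ⬝ᵥ y = (x ∘ Sum.inl) ⬝ᵥ (y ∘ Sum.inl) + (x ∘ Sum.inr) ⬝ᵥ (y ∘ Sum.inr) := by
  simp [dotProduct]

lemma dotProduct_dilation_mulVec (Z : Matrix ι κ ℝ) (x : ι ⊕ κ → ℝ) :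
    x ⬝ᵥ dilation Z *ᵥ x = 2 * ((x ∘ Sum.inl) ⬝ᵥ Z *ᵥ (x ∘ Sum.inr)) := by
  rw [dilation_mulVec, dotProduct_sum_split, Sum.elim_comp_inl, Sum.elim_comp_inr,
    mulVec_transpose, dotProduct_comm (x ∘ Sum.inr), ← dotProduct_mulVec]
  ring

lemma dilation_mulVec_dotProduct_self (Z : Matrix ι κ ℝ) (x : ι ⊕ κ → ℝ) :
    dilation Z *ᵥ x ⬝ᵥ dilation Z *ᵥ x
      = Z *ᵥ (x ∘ Sum.inr) ⬝ᵥ Z *ᵥ (x ∘ Sum.inr)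
        + Zᵀ *ᵥ (x ∘ Sum.inl) ⬝ᵥ Zᵀ *ᵥ (x ∘ Sum.inl) := by
  rw [dilation_mulVec, dotProduct_sum_split, Sum.elim_comp_inl, Sum.elim_comp_inr]

/-- The variance is at most the second moment, so Bernstein's variance hypotheses can be stated for
uncentred matrices. -/
lemma sum_mul_sub_mean_dotProduct_le (hp1 : ∑ t, p t = 1) (v : T → ι → ℝ) :
    ∑ t, p t * ((v t - ∑ s, p s • v s) ⬝ᵥ (v t - ∑ s, p s • v s)) ≤ ∑ t, p t * (v t ⬝ᵥ v t) := by
  set w := ∑ s, p s • v s with hw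
  have h1 : ∑ t, p t * (v t ⬝ᵥ w) = w ⬝ᵥ w := by
    conv_rhs => enter [1]; rw [hw]
    simp [sum_dotProduct]
  have hw0 : 0 ≤ w ⬝ᵥ w := by simpa using dotProduct_star_self_nonneg w
  have h2 : ∑ t, p t * ((v t - w) ⬝ᵥ (v t - w))
      = ∑ t, p t * (v t ⬝ᵥ v t) - 2 * ∑ t, p t * (v t ⬝ᵥ w) + (∑ t, p t) * (w ⬝ᵥ w) := by
    rw [Finset.mul_sum, Finset.sum_mul, ← Finset.sum_sub_distrib, ← Finset.sum_add_distrib]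
    refine Finset.sum_congr rfl fun t _ => ?_
    simp only [dotProduct_sub, sub_dotProduct, dotProduct_comm w (v t)]
    ring
  rw [h2, h1, hp1]; linarith

/-- `‖Z‖ ≤ y` for the operator norm between Euclidean spaces. -/
def OpNormLE (Z : Matrix ι κ ℝ) (y : ℝ) : Prop :=
  ∀ a b, 2 * (a ⬝ᵥ Z *ᵥ b) ≤ y * (a ⬝ᵥ a + b ⬝ᵥ b)

lemma OpNormLE.neg_le {Z : Matrix ι κ ℝ} {y : ℝ} (h : OpNormLE Z y) (a : ι → ℝ) (b : κ → ℝ) :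
    -(2 * (a ⬝ᵥ Z *ᵥ b)) ≤ y * (a ⬝ᵥ a + b ⬝ᵥ b) := by
  have := h (-a) b
  simpa using this

open Classical in
/-- **Matrix Bernstein inequality** for i.i.d. rectangular matrices on a finite probability space. -/
theorem sum_prod_filter_not_opNormLE_le (hp : ∀ t, 0 ≤ p t) (hp1 : ∑ t, p t = 1)
    (Z : T → Matrix ι κ ℝ) {ρ σ θ a : ℝ} (hρ : ∀ t, OpNormLE (Z t) ρ)
    (hσ₁ : ∀ b, ∑ t, p t * (Z t *ᵥ b ⬝ᵥ Z t *ᵥ b) ≤ σ * (b ⬝ᵥ b))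
    (hσ₂ : ∀ b, ∑ t, p t * ((Z t)ᵀ *ᵥ b ⬝ᵥ (Z t)ᵀ *ᵥ b) ≤ σ * (b ⬝ᵥ b))
    (hθ : 0 < θ) (ha : 0 < a) (hθρ : θ * (2 * ρ) ≤ a) (n : ℕ) (y : ℝ) :
    ∑ x : Fin n → T with ¬ OpNormLE (∑ j, (Z (x j) - ∑ t, p t • Z t)) y, ∏ j, p (x j)
      ≤ (Fintype.card ι + Fintype.card κ)
        * Real.exp (n * ((Real.exp a - 1 - a) / a ^ 2 * θ ^ 2 * σ) - θ * y) := by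
  set M := ∑ t, p t • Z t with hM
  have hlin (s : Finset (Fin n)) (F : Fin n → Matrix ι κ ℝ) :
      dilation (∑ j ∈ s, F j) = ∑ j ∈ s, dilation (F j) := by
    ext (i | i) (j | j) <;> simp [dilation, Matrix.sum_apply, transpose_sum]
  have hmean {v : T → ℝ} {w : ℝ} (hv : ∀ t, |v t| ≤ w) : |∑ t, p t * v t| ≤ w := by
    refine (Finset.abs_sum_le_sum_abs _ _).trans ?_
    calc ∑ t, |p t * v t| ≤ ∑ t, p t * w := Finset.sum_le_sum fun t _ => by
          rw [abs_mul, abs_of_nonneg (hp t)]; exact mul_le_mul_of_nonneg_left (hv t) (hp t)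
      _ = w := by rw [← Finset.sum_mul, hp1, one_mul]
  have habs (t : T) (a : ι → ℝ) (b : κ → ℝ) : |2 * (a ⬝ᵥ Z t *ᵥ b)| ≤ ρ * (a ⬝ᵥ a + b ⬝ᵥ b) :=
    abs_le'.mpr ⟨hρ t a b, (hρ t).neg_le a b⟩
  -- The dilation turns the operator norm into a largest eigenvalue. Centring at most doubles the
  -- uniform bound, whence 2ρ.
  have h := sum_prod_filter_le_symm (ι := ι ⊕ κ) hp hp1 (D := fun t => dilation (Z t - M))
    (fun t => dilation_isSymm _) ?_ (R := 2 * ρ) (σ := σ) ?_ ?_ hθ ha hθρ n y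
  · rw [Fintype.card_sum, Nat.cast_add] at h
    refine le_trans (le_of_eq ?_) h
    congr 1
    ext x
    simp only [Finset.mem_filter, Finset.mem_univ, true_and, not_iff_not]
    rw [← hlin]
    constructor
    · intro hx v
      rw [dotProduct_dilation_mulVec, dotProduct_sum_split v v]
      exact hx _ _
    · intro hx a b
      have := hx (Sum.elim a b)
      rwa [dotProduct_dilation_mulVec, dotProduct_sum_split (Sum.elim a b), Sum.elim_comp_inl,
        Sum.elim_comp_inr] at this
  · have h0 : ∑ t, p t • (Z t - M) = 0 := by
      simp only [smul_sub, Finset.sum_sub_distrib, ← Finset.sum_smul, hp1, one_smul, ← hM, sub_self]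
    have h0' (i : ι) (j : κ) : ∑ t, p t * (Z t i j - M i j) = 0 := by
      have := congrFun (congrFun h0 i) j
      simpa [Matrix.sum_apply] using this
    ext (i | i) (j | j) <;> simp [dilation, Matrix.sum_apply, h0']
  · intro t x
    rw [dotProduct_dilation_mulVec, dotProduct_sum_split x x]
    set a := x ∘ Sum.inl
    set b := x ∘ Sum.inr
    have e : 2 * (a ⬝ᵥ (Z t - M) *ᵥ b) = 2 * (a ⬝ᵥ Z t *ᵥ b) - ∑ s, p s * (2 * (a ⬝ᵥ Z s *ᵥ b)) := by
      rw [sub_mulVec, dotProduct_sub, mul_sub, hM, sum_mulVec, dotProduct_sum, Finset.mul_sum]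
      congr 1
      refine Finset.sum_congr rfl fun s _ => ?_
      rw [smul_mulVec, dotProduct_smul, smul_eq_mul]; ring
    rw [e]
    refine (abs_sub _ _).trans ?_
    have := hmean (fun s => habs s a b)
    have := habs t a b
    linarith
  · intro x
    simp only [dilation_mulVec_dotProduct_self, mul_add, Finset.sum_add_distrib]
    rw [dotProduct_sum_split x x, mul_add, add_comm]
    refine add_le_add (le_trans ?_ (hσ₂ (x ∘ Sum.inl))) (le_trans ?_ (hσ₁ (x ∘ Sum.inr)))
    · have e (t : T) : (Z t - M)ᵀ *ᵥ (x ∘ Sum.inl) = (Z t)ᵀ *ᵥ (x ∘ Sum.inl)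
          - ∑ s, p s • ((Z s)ᵀ *ᵥ (x ∘ Sum.inl)) := by
        rw [transpose_sub, sub_mulVec, hM, transpose_sum, sum_mulVec]
        simp only [transpose_smul, smul_mulVec]
      simp only [e]
      exact sum_mul_sub_mean_dotProduct_le hp1 _
    · have e (t : T) : (Z t - M) *ᵥ (x ∘ Sum.inr) = Z t *ᵥ (x ∘ Sum.inr)
          - ∑ s, p s • (Z s *ᵥ (x ∘ Sum.inr)) := by
        rw [sub_mulVec, hM, sum_mulVec]
        simp only [smul_mulVec]
      simp only [e]
      exact sum_mul_sub_mean_dotProduct_le hp1 _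

end Rectangular

end Bernstein

/-! ### Concentration of the noise matrix in operator and Frobenius norms. -/

section Noise

open Matrix

/-- The squared Frobenius norm. -/
def frobSq {ι κ : Type*} [Fintype ι] [Fintype κ] (M : Matrix ι κ ℝ) : ℝ := ∑ i, ∑ j, M i j ^ 2

/-- The label `±1` coded by a Boolean. -/
def signOf (b : Bool) : ℝ := if b then 1 else -1

lemma signOf_sq (b : Bool) : signOf b ^ 2 = 1 := by cases b <;> simp [signOf]

variable {V : Type*} [Fintype V]

/-- The law of one observation `(u, v, ±)`. -/
def obsWeight (S : Matrix V V ℝ) (t : V × V × Bool) : ℝ :=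
  (1 + signOf t.2.2 * S t.1 t.2.1) / (2 * (Fintype.card V : ℝ) ^ 2)

lemma sum_obsWeight_mul (S : Matrix V V ℝ) (g : V → V → ℝ) :
    ∑ t, obsWeight S t * g t.1 t.2.1 = (∑ u, ∑ v, g u v) / (Fintype.card V : ℝ) ^ 2 := by
  simp only [Fintype.sum_prod_type, Fintype.sum_bool, obsWeight, signOf, Finset.sum_div]
  refine Finset.sum_congr rfl fun u _ => Finset.sum_congr rfl fun v _ => ?_
  simp only [if_true, Bool.false_eq_true, if_false]
  ring

lemma sum_obsWeight_mul_sign (S : Matrix V V ℝ) (g : V → V → ℝ) :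
    ∑ t, obsWeight S t * (signOf t.2.2 * g t.1 t.2.1)
      = (∑ u, ∑ v, S u v * g u v) / (Fintype.card V : ℝ) ^ 2 := by
  simp only [Fintype.sum_prod_type, Fintype.sum_bool, obsWeight, signOf, Finset.sum_div]
  refine Finset.sum_congr rfl fun u _ => Finset.sum_congr rfl fun v _ => ?_
  simp only [if_true, Bool.false_eq_true, if_false]
  ring

lemma sum_obsWeight [Nonempty V] (S : Matrix V V ℝ) : ∑ t, obsWeight S t = 1 := by
  have := sum_obsWeight_mul S fun _ _ => 1
  simp only [mul_one] at this
  rw [this]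
  have : (Fintype.card V : ℝ) ≠ 0 := by exact_mod_cast Fintype.card_ne_zero
  simp only [Finset.sum_const, Finset.card_univ, nsmul_eq_mul]
  field_simp

variable [DecidableEq V]

/-- `n` times the difference between the empirical and the true functional. -/
def noise {n : ℕ} (S : Matrix V V ℝ) (x : Fin n → V × V × Bool) : Matrix V V ℝ :=
  ∑ j, (signOf (x j).2.2 • Matrix.single (x j).1 (x j).2.1 1
    - (1 / (Fintype.card V : ℝ) ^ 2) • S)

lemma sum_obsWeight_smul_single (S : Matrix V V ℝ) :
    ∑ t, obsWeight S t • (signOf t.2.2 • Matrix.single t.1 t.2.1 (1 : ℝ))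
      = (1 / (Fintype.card V : ℝ) ^ 2) • S := by
  ext a b
  have := sum_obsWeight_mul_sign S fun u v => if u = a ∧ v = b then 1 else 0
  simp only [Matrix.sum_apply, Matrix.smul_apply, smul_eq_mul, single_apply]
  rw [this]
  have e : ∑ u, ∑ v, S u v * (if u = a ∧ v = b then 1 else 0) = S a b := by
    simp [ite_and]
  rw [e]; ring

/-- The accuracy 4.96 is what the Bernstein exponent below requires: (4.96 - 2.6)/4 - 1.6 = -1.01.
-/
lemma exp_eight_fifths_le : Real.exp (8 / 5) ≤ 4.96 := by
  have h : Real.exp (8 / 5) ^ 5 = Real.exp 1 ^ 8 := by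
    rw [← Real.exp_nat_mul, ← Real.exp_nat_mul]; norm_num
  have h2 : Real.exp 1 ^ 8 ≤ 2.7182818286 ^ 8 := by
    gcongr; exact Real.exp_one_lt_d9.le
  refine le_of_pow_le_pow_left₀ (n := 5) (by norm_num) (by norm_num) ?_
  rw [h]
  exact h2.trans (by norm_num)

open Classical in
/-- The operator norm of the noise matrix exceeds its typical size with small probability. -/
lemma sum_prod_filter_noise_opNorm [Nonempty V] {S : Matrix V V ℝ} (hS : ∀ t, 0 ≤ obsWeight S t)
    {n : ℕ} {τ : ℝ} (hτ : 0 < τ) (hn : Fintype.card V * τ ≤ n) :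
    ∑ x : Fin n → V × V × Bool with
        ¬ OpNormLE (noise S x) (n * (2 * Real.sqrt (τ / (n * Fintype.card V)))),
      ∏ j, obsWeight S (x j)
      ≤ 2 * Fintype.card V * Real.exp (-(1.01 * τ)) := by
  set m : ℝ := (Fintype.card V : ℝ) with hm
  have hm0 : 0 < m := by rw [hm]; exact_mod_cast Fintype.card_pos
  have hn0 : (0 : ℝ) < n := lt_of_lt_of_le (by positivity) hn
  set q := Real.sqrt (m * τ / n) with hq
  have hq0 : 0 < q := Real.sqrt_pos.mpr (by positivity)
  have hq2 : q ^ 2 = m * τ / n := Real.sq_sqrt (by positivity)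
  have hq1 : q ≤ 1 := Real.sqrt_le_one.mpr ((div_le_one hn0).mpr hn)
  have hqs : q * Real.sqrt (τ / (n * m)) = τ / n := by
    rw [hq, ← Real.sqrt_mul (by positivity), show m * τ / n * (τ / (n * m)) = (τ / n) ^ 2 by
      field_simp, Real.sqrt_sq (by positivity)]
  -- With θ = (a/2)q the exponent is ((e^a - 1 - a)/4 - a)τ, minimal at a = log 5, close to 8/5. The
  -- constraint θ · 2ρ ≤ a is q ≤ 1, which is mτ ≤ n.
  have h := sum_prod_filter_not_opNormLE_le hS (sum_obsWeight S)
    (fun t => signOf t.2.2 • Matrix.single t.1 t.2.1 (1 : ℝ)) (ρ := 1) (σ := 1 / m)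
    (θ := 4 / 5 * q) (a := 8 / 5) ?_ ?_ ?_ (by positivity) (by norm_num) (by linarith) n
    (n * (2 * Real.sqrt (τ / (n * m))))
  · rw [sum_obsWeight_smul_single] at h
    refine h.trans ?_
    rw [← two_mul]
    gcongr
    have e1 : (n : ℝ) * ((Real.exp (8 / 5) - 1 - 8 / 5) / (8 / 5) ^ 2 * (4 / 5 * q) ^ 2 * (1 / m))
        = (Real.exp (8 / 5) - 2.6) / 4 * τ := by
      rw [mul_pow, hq2]; field_simp; ring
    have e2 : 4 / 5 * q * (n * (2 * Real.sqrt (τ / (n * m)))) = 1.6 * τ := by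
      rw [show 4 / 5 * q * (n * (2 * Real.sqrt (τ / (n * m))))
        = 1.6 * n * (q * Real.sqrt (τ / (n * m))) by ring, hqs]
      field_simp
    rw [e1, e2]
    have := exp_eight_fifths_le
    nlinarith
  · rintro ⟨u, v, s⟩ a b
    have ha : a u ^ 2 ≤ a ⬝ᵥ a := by
      rw [sq]
      exact Finset.single_le_sum (f := fun i => a i * a i) (fun i _ => mul_self_nonneg _)
        (Finset.mem_univ u)
    have hb : b v ^ 2 ≤ b ⬝ᵥ b := by
      rw [sq]
      exact Finset.single_le_sum (f := fun i => b i * b i) (fun i _ => mul_self_nonneg _)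
        (Finset.mem_univ v)
    simp only [smul_mulVec, dotProduct_smul, smul_eq_mul, single_mulVec, one_mul]
    have e : a ⬝ᵥ Function.update 0 u (b v) = a u * b v := by
      rw [← Pi.single, dotProduct_single]
    rw [e]
    cases s <;> simp only [signOf, if_true, Bool.false_eq_true, if_false] <;>
      nlinarith [sq_nonneg (a u - b v), sq_nonneg (a u + b v)]
  · intro b
    have e (t : V × V × Bool) : (signOf t.2.2 • Matrix.single t.1 t.2.1 (1 : ℝ)) *ᵥ b ⬝ᵥ
        (signOf t.2.2 • Matrix.single t.1 t.2.1 (1 : ℝ)) *ᵥ b = b t.2.1 ^ 2 := by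
      simp only [smul_mulVec, dotProduct_smul, smul_dotProduct, smul_eq_mul, single_mulVec, one_mul]
      rw [← Pi.single, dotProduct_single, Pi.single_eq_same]
      linear_combination b t.2.1 ^ 2 * signOf_sq t.2.2
    simp only [e]
    rw [sum_obsWeight_mul S fun _ v => b v ^ 2]
    simp only [Finset.sum_const, Finset.card_univ, nsmul_eq_mul, ← hm, dotProduct, ← sq]
    apply le_of_eq; field_simp
  · intro b
    have e (t : V × V × Bool) : (signOf t.2.2 • Matrix.single t.1 t.2.1 (1 : ℝ))ᵀ *ᵥ b ⬝ᵥ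
        (signOf t.2.2 • Matrix.single t.1 t.2.1 (1 : ℝ))ᵀ *ᵥ b = b t.1 ^ 2 := by
      simp only [transpose_smul, transpose_single, smul_mulVec, dotProduct_smul, smul_dotProduct,
        smul_eq_mul, single_mulVec, one_mul]
      rw [← Pi.single, dotProduct_single, Pi.single_eq_same]
      linear_combination b t.1 ^ 2 * signOf_sq t.2.2
    simp only [e]
    rw [sum_obsWeight_mul S fun u _ => b u ^ 2]
    simp only [Finset.sum_const, Finset.card_univ, nsmul_eq_mul, ← hm, dotProduct, ← sq,
      ← Finset.mul_sum]
    apply le_of_eq; field_simp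

lemma mul_single_mul_apply {ι κ : Type*} (B : Matrix ι V ℝ) (C : Matrix V κ ℝ) (u v : V) (i : ι) (k : κ) :
    (B * Matrix.single u v (1 : ℝ) * C) i k = B i u * C v k := by
  rw [Matrix.mul_assoc, mul_apply]
  simp [mul_apply, single_apply, ite_and]

variable {ι κ : Type*} [Fintype ι] [Fintype κ]

lemma dotProduct_sq_le {ι : Type*} [Fintype ι] (a b : ι → ℝ) :
    (a ⬝ᵥ b) ^ 2 ≤ (a ⬝ᵥ a) * (b ⬝ᵥ b) := by
  simpa only [dotProduct, ← sq] using Finset.sum_mul_sq_le_sq_mul_sq Finset.univ a b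

lemma dotProduct_self_nonneg_real {ι : Type*} [Fintype ι] (a : ι → ℝ) : 0 ≤ a ⬝ᵥ a := by
  simpa using dotProduct_star_self_nonneg a

/-- A matrix as a single column. -/
def asColumn {ι κ : Type*} (M : Matrix ι κ ℝ) : Matrix (ι × κ) Unit ℝ := of fun i _ => M i.1 i.2

lemma asColumn_dotProduct (M : Matrix ι κ ℝ) (a : ι × κ → ℝ) (b : Unit → ℝ) :
    a ⬝ᵥ asColumn M *ᵥ b = (a ⬝ᵥ fun i => M i.1 i.2) * b () := by
  simp [asColumn, mulVec, dotProduct, Finset.sum_mul, mul_assoc]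

lemma column_dotProduct_self (M : Matrix ι κ ℝ) :
    ((fun i : ι × κ => M i.1 i.2) ⬝ᵥ fun i => M i.1 i.2) = frobSq M := by
  simp [frobSq, dotProduct, Fintype.sum_prod_type, sq]

/-- A single column has operator norm equal to its Euclidean length. Hence matrix Bernstein also
yields a bound for Frobenius norms, with dimension card ι · card κ + 1. -/
lemma opNormLE_asColumn_iff (M : Matrix ι κ ℝ) {y : ℝ} (hy : 0 ≤ y) :
    OpNormLE (asColumn M) y ↔ frobSq M ≤ y ^ 2 := by
  have hu (b : Unit → ℝ) : b ⬝ᵥ b = b () ^ 2 := by simp [dotProduct, sq]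
  constructor
  · intro h
    have h0 : 0 ≤ frobSq M := by rw [← column_dotProduct_self]; exact dotProduct_self_nonneg_real _
    have := h (fun i => M i.1 i.2) fun _ => Real.sqrt (frobSq M)
    rw [asColumn_dotProduct, column_dotProduct_self, hu, Real.sq_sqrt h0] at this
    rcases h0.eq_or_lt with h1 | h1
    · rw [← h1]; positivity
    · have h2 : Real.sqrt (frobSq M) ≤ y := by nlinarith
      calc frobSq M = Real.sqrt (frobSq M) ^ 2 := (Real.sq_sqrt h0).symm
        _ ≤ y ^ 2 := by gcongr
  · intro h a b
    rw [asColumn_dotProduct, hu]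
    have h1 := dotProduct_sq_le a fun i => M i.1 i.2
    rw [column_dotProduct_self] at h1
    set c := a ⬝ᵥ fun i => M i.1 i.2
    have ha := dotProduct_self_nonneg_real a
    have h2 : c ^ 2 ≤ (a ⬝ᵥ a) * y ^ 2 := h1.trans (mul_le_mul_of_nonneg_left h ha)
    refine abs_le_of_sq_le_sq' ?_ (by positivity) |>.2
    have h3 : c ^ 2 * b () ^ 2 ≤ (a ⬝ᵥ a) * y ^ 2 * b () ^ 2 :=
      mul_le_mul_of_nonneg_right h2 (sq_nonneg _)
    nlinarith [mul_nonneg (sq_nonneg y) (sq_nonneg (a ⬝ᵥ a - b () ^ 2))]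

lemma frobSq_mul_single_mul (B : Matrix ι V ℝ) (C : Matrix V κ ℝ) (u v : V) (b : Bool) :
    frobSq (signOf b • (B * Matrix.single u v (1 : ℝ) * C))
      = (∑ i, B i u ^ 2) * ∑ k, C v k ^ 2 := by
  simp only [frobSq, Matrix.smul_apply, mul_single_mul_apply, smul_eq_mul, mul_pow, signOf_sq, one_mul,
    Finset.sum_mul_sum]

open Classical in
/-- A Bernstein bound for the Frobenius norm of `B * noise * C`. -/
lemma sum_prod_filter_noise_frobSq [Nonempty V] {S : Matrix V V ℝ} (hS : ∀ t, 0 ≤ obsWeight S t)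
    {n : ℕ} (B : Matrix ι V ℝ) (C : Matrix V κ ℝ) {ρ s : ℝ} (hρ0 : 0 < ρ) (hs : 0 < s)
    (hρ : ∀ u v, (∑ i, B i u ^ 2) * ∑ k, C v k ^ 2 ≤ ρ ^ 2) :
    ∑ x : Fin n → V × V × Bool with
        ¬ frobSq (B * noise S x * C)
          ≤ 8 * n * (frobSq B * frobSq C / (Fintype.card V : ℝ) ^ 2) * s + 32 * ρ ^ 2 * s ^ 2,
      ∏ j, obsWeight S (x j)
      ≤ (Fintype.card ι * Fintype.card κ + 1) * Real.exp (-s) := by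
  set m : ℝ := (Fintype.card V : ℝ) with hm
  set v := frobSq B * frobSq C / m ^ 2 with hv
  have hv0 : 0 ≤ v := by
    have h1 : 0 ≤ frobSq B := Finset.sum_nonneg fun i _ => Finset.sum_nonneg fun _ _ => sq_nonneg _
    have h2 : 0 ≤ frobSq C := Finset.sum_nonneg fun i _ => Finset.sum_nonneg fun _ _ => sq_nonneg _
    positivity
  -- The choice θ = 1/(d + 2ρ), a = 1 and threshold y = 2s(d + 2ρ) gives θy = 2s, while the variance
  -- term is at most (e - 2)s ≤ s; the exponent is then at most -s. Squaring y with (d + 2ρ)² ≤ 2d²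
  -- + 8ρ² gives the constants 8 and 32.
  set d := Real.sqrt (n * v / s) with hd
  have hd0 : 0 ≤ d := Real.sqrt_nonneg _
  have hd2 : d ^ 2 = n * v / s := Real.sq_sqrt (by positivity)
  set y := 2 * s * (d + 2 * ρ) with hy
  have hy0 : 0 ≤ y := by positivity
  have hy2 : y ^ 2 ≤ 8 * n * v * s + 32 * ρ ^ 2 * s ^ 2 := by
    have e : 8 * n * v * s = 8 * s ^ 2 * d ^ 2 := by rw [hd2]; field_simp
    rw [e, hy]
    nlinarith [mul_nonneg (sq_nonneg s) (sq_nonneg (d - 2 * ρ))]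
  let Z : V × V × Bool → Matrix (ι × κ) Unit ℝ := fun t =>
    asColumn (signOf t.2.2 • (B * Matrix.single t.1 t.2.1 (1 : ℝ) * C))
  have hfrob (t : V × V × Bool) : frobSq (signOf t.2.2 • (B * Matrix.single t.1 t.2.1 (1 : ℝ) * C))
      = (∑ i, B i t.1 ^ 2) * ∑ k, C t.2.1 k ^ 2 := frobSq_mul_single_mul _ _ _ _ _
  have hmean : ∑ t, obsWeight S t * ((∑ i, B i t.1 ^ 2) * ∑ k, C t.2.1 k ^ 2) = v := by
    rw [sum_obsWeight_mul S fun u v => (∑ i, B i u ^ 2) * ∑ k, C v k ^ 2, ← Finset.sum_mul_sum, hv,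
      frobSq, frobSq, Finset.sum_comm]
  have hθ : 0 < 1 / (d + 2 * ρ) := by positivity
  have h := sum_prod_filter_not_opNormLE_le hS (sum_obsWeight S) Z (ρ := ρ) (σ := v)
    (θ := 1 / (d + 2 * ρ)) (a := 1) ?_ ?_ ?_ hθ one_pos ?_ n y
  · have hsum (x : Fin n → V × V × Bool) :
        ∑ j, (Z (x j) - ∑ t, obsWeight S t • Z t) = asColumn (B * noise S x * C) := by
      have hlin : ∑ t, obsWeight S t • Z t = asColumn (B * ((1 / m ^ 2) • S) * C) := by
        rw [← sum_obsWeight_smul_single, Matrix.mul_sum, Matrix.sum_mul]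
        ext i j
        simp only [Z, asColumn, Matrix.sum_apply, Matrix.smul_apply, of_apply, Matrix.mul_smul,
          Matrix.smul_mul]
      rw [hlin, noise, Matrix.mul_sum, Matrix.sum_mul]
      ext i j
      simp only [Z, asColumn, Matrix.sum_apply, Matrix.smul_apply, of_apply, Matrix.mul_smul,
        Matrix.smul_mul, Matrix.mul_sub, Matrix.sub_mul, Matrix.sub_apply, ← hm]
    refine le_trans (Finset.sum_le_sum_of_subset_of_nonneg ?_ fun x _ _ =>
      Finset.prod_nonneg fun j _ => hS _) (h.trans ?_)
    · intro x hx
      simp only [Finset.mem_filter, Finset.mem_univ, true_and] at hx ⊢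
      rw [hsum, opNormLE_asColumn_iff _ hy0]
      exact fun hc => hx (hc.trans hy2)
    · rw [Fintype.card_prod, Fintype.card_unit, Nat.cast_mul, Nat.cast_one]
      gcongr
      have e1 : 1 / (d + 2 * ρ) * y = 2 * s := by rw [hy]; field_simp
      have e2 : (n : ℝ) * v = s * d ^ 2 := by rw [hd2]; field_simp
      have e3 : (d * (1 / (d + 2 * ρ))) ^ 2 ≤ 1 := by
        rw [mul_one_div]
        refine pow_le_one₀ (by positivity) ((div_le_one (by positivity)).mpr (by linarith))
      have e4 : Real.exp 1 - 1 - 1 ≤ 1 := by have := Real.exp_one_lt_d9; linarith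
      have e5 : (n : ℝ) * ((Real.exp 1 - 1 - 1) / 1 ^ 2 * (1 / (d + 2 * ρ)) ^ 2 * v)
          = (Real.exp 1 - 1 - 1) * (s * (d * (1 / (d + 2 * ρ))) ^ 2) := by
        linear_combination (Real.exp 1 - 1 - 1) * (1 / (d + 2 * ρ)) ^ 2 * e2
      rw [e1, e5]
      have e6 : (Real.exp 1 - 1 - 1) * (s * (d * (1 / (d + 2 * ρ))) ^ 2) ≤ 1 * (s * 1) := by
        gcongr
      linarith
  · intro t
    rw [opNormLE_asColumn_iff _ hρ0.le, hfrob]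
    exact hρ _ _
  · intro b
    have e (t : V × V × Bool) : Z t *ᵥ b ⬝ᵥ Z t *ᵥ b
        = ((∑ i, B i t.1 ^ 2) * ∑ k, C t.2.1 k ^ 2) * (b ⬝ᵥ b) := by
      rw [← hfrob, asColumn_dotProduct, ← column_dotProduct_self, dotProduct_comm]
      simp only [dotProduct, Z, asColumn, mulVec, of_apply, Finset.univ_unique, Finset.sum_singleton,
        Finset.sum_mul]
      refine Finset.sum_congr rfl fun i _ => by ring
    simp only [e, ← mul_assoc, ← Finset.sum_mul]
    simp only [mul_assoc]
    rw [← hmean, Finset.sum_mul]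
  · intro a
    have e (t : V × V × Bool) : (Z t)ᵀ *ᵥ a ⬝ᵥ (Z t)ᵀ *ᵥ a
        ≤ ((∑ i, B i t.1 ^ 2) * ∑ k, C t.2.1 k ^ 2) * (a ⬝ᵥ a) := by
      rw [← hfrob, ← column_dotProduct_self]
      refine le_trans (le_of_eq ?_) (dotProduct_sq_le _ a)
      simp [dotProduct, Z, asColumn, mulVec, sq]
    refine (Finset.sum_le_sum fun t _ => mul_le_mul_of_nonneg_left (e t) (hS t)).trans ?_
    rw [← hmean, Finset.sum_mul]
    exact le_of_eq (Finset.sum_congr rfl fun t _ => by ring)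
  · rw [one_div, inv_mul_le_iff₀ (by positivity)]
    linarith

end Noise

/-! ### The nuclear norm: duality, sign matrices and subgradients. -/

section Nuclear

open Matrix

variable {V : Type*} [Fintype V] [DecidableEq V]

lemma conj_diagonal_mul {U : Matrix V V ℝ} (h : Uᵀ * U = 1) (d e : V → ℝ) :
    U * diagonal d * Uᵀ * (U * diagonal e * Uᵀ) = U * diagonal (fun i => d i * e i) * Uᵀ := by
  rw [show U * diagonal d * Uᵀ * (U * diagonal e * Uᵀ)
    = U * diagonal d * (Uᵀ * U) * (diagonal e * Uᵀ) by simp only [Matrix.mul_assoc], h,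
    Matrix.mul_one, ← Matrix.mul_assoc, Matrix.mul_assoc U, diagonal_mul_diagonal]

lemma conj_diagonal_isSymm (U : Matrix V V ℝ) (d : V → ℝ) : (U * diagonal d * Uᵀ).IsSymm := by
  simp [IsSymm, Matrix.mul_assoc]

lemma trace_conj_diagonal {U : Matrix V V ℝ} (h : Uᵀ * U = 1) (d : V → ℝ) :
    (U * diagonal d * Uᵀ).trace = ∑ i, d i := by
  rw [trace_mul_comm, ← Matrix.mul_assoc, h, Matrix.one_mul, trace_diagonal]

lemma nuclearNorm_conj_diagonal {U : Matrix V V ℝ} (h : Uᵀ * U = 1) (d : V → ℝ) :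
    nuclearNorm (U * diagonal d * Uᵀ) = ∑ i, |d i| := by
  have key : CFC.abs (U * diagonal d * Uᵀ) = U * diagonal (fun i => |d i|) * Uᵀ := by
    refine CFC.sqrt_unique ?_ (posSemidef_conj_diagonal U fun i => abs_nonneg _).nonneg
    rw [star_eq_conjTranspose, conjTranspose_eq_transpose_of_trivial,
      (conj_diagonal_isSymm U d).eq, conj_diagonal_mul h, conj_diagonal_mul h]
    simp only [abs_mul_abs_self]
  rw [nuclearNorm, key, trace_conj_diagonal h]

/-- In an orthonormal eigenbasis u_i of S the trace is ∑ d_i ⟨u_i, M u_i⟩, and each inner product is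
at most y in absolute value. -/
lemma trace_transpose_mul_le_nuclearNorm {S M : Matrix V V ℝ} (hS : S.IsSymm) {y : ℝ}
    (hM : OpNormLE M y) : (Mᵀ * S).trace ≤ y * nuclearNorm S := by
  obtain ⟨U, d, h1, h2, rfl⟩ := exists_orthogonal_diagonalization hS
  rw [nuclearNorm_conj_diagonal h1]
  have e : (Mᵀ * (U * diagonal d * Uᵀ)).trace
      = ∑ i, d i * ((U *ᵥ Pi.single i 1) ⬝ᵥ M *ᵥ (U *ᵥ Pi.single i 1)) := by
    rw [← Matrix.mul_assoc, trace_mul_comm, ← Matrix.mul_assoc, ← Matrix.mul_assoc]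
    simp only [trace, diag, mul_diagonal]
    refine Finset.sum_congr rfl fun i _ => ?_
    rw [mul_comm]
    congr 1
    have h3 : (U *ᵥ Pi.single i 1) ⬝ᵥ M *ᵥ (U *ᵥ Pi.single i 1) = (Uᵀ * M * U) i i := by
      rw [mulVec_mulVec, dotProduct_comm, dotProduct_mulVec, ← mulVec_transpose, mulVec_mulVec]
      simp only [mulVec_single_one, dotProduct_single, mul_one, col_apply, Matrix.mul_assoc]
    rw [h3, ← transpose_apply (Uᵀ * M * U)]
    simp only [transpose_mul, transpose_transpose, Matrix.mul_assoc]
  rw [e, Finset.mul_sum]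
  refine Finset.sum_le_sum fun i _ => ?_
  have h3 := hM (U *ᵥ Pi.single i 1) (U *ᵥ Pi.single i 1)
  have h4 := hM.neg_le (U *ᵥ Pi.single i 1) (U *ᵥ Pi.single i 1)
  rw [col_dotProduct_self h1] at h3 h4
  set c := (U *ᵥ Pi.single i 1) ⬝ᵥ M *ᵥ (U *ᵥ Pi.single i 1)
  have hc : |c| ≤ y := abs_le'.mpr ⟨by linarith, by linarith⟩
  calc d i * c ≤ |d i| * |c| := by rw [← abs_mul]; exact le_abs_self _
    _ ≤ |d i| * y := by gcongr
    _ = y * |d i| := mul_comm _ _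

/-- `P` is the orthogonal projector onto the support of `S` and `G` is the sign of `S`. -/
structure IsSignOf (S P G : Matrix V V ℝ) : Prop where
  proj_symm : P.IsSymm
  sign_symm : G.IsSymm
  proj_mul_proj : P * P = P
  sign_mul_sign : G * G = P
  proj_mul_sign : P * G = G
  sign_mul_proj : G * P = G
  proj_mul : P * S = S
  mul_proj : S * P = S
  trace_sign_mul : (G * S).trace = nuclearNorm S
  trace_proj : P.trace = S.rank
  opNorm_sign : OpNormLE G 1
  projSq_eq : ∀ x : V → ℝ, projSq (supp S) (WithLp.toLp 2 x) = P *ᵥ x ⬝ᵥ P *ᵥ x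

/-- The range of the explicit projector is spanned by eigenvectors with d_i ≠ 0. Conversely it fixes
every eigenvector with nonzero eigenvalue, since PS = S and the eigenvalue can be cancelled. -/
lemma starProjection_supp_eq {U : Matrix V V ℝ} {d : V → ℝ} (h1 : Uᵀ * U = 1) (x : V → ℝ) :
    (supp (U * diagonal d * Uᵀ)).starProjection (WithLp.toLp 2 x)
      = WithLp.toLp 2 ((U * diagonal (fun i => if d i = 0 then 0 else 1) * Uᵀ) *ᵥ x) := by
  set P := U * diagonal (fun i => if d i = 0 then (0 : ℝ) else 1) * Uᵀ with hP
  set S := U * diagonal d * Uᵀ with hS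
  have hPS : P * S = S := by
    rw [hP, hS, conj_diagonal_mul h1]
    congr 3; ext i; split_ifs with h <;> simp [h]
  refine Submodule.eq_starProjection_of_mem_of_inner_eq_zero ?_ ?_
  · have e : WithLp.toLp 2 (P *ᵥ x) = ∑ i, (if d i = 0 then (0 : ℝ) else (Uᵀ *ᵥ x) i) •
        WithLp.toLp 2 (U *ᵥ Pi.single i 1) := by
      ext v
      rw [hP, ← mulVec_mulVec, ← mulVec_mulVec]
      simp only [mulVec_single_one, WithLp.ofLp_sum, WithLp.ofLp_smul, Finset.sum_apply,
        Pi.smul_apply, smul_eq_mul]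
      rw [mulVec, dotProduct]
      refine Finset.sum_congr rfl fun i _ => ?_
      rw [mulVec_diagonal]
      split_ifs with h <;> simp [mul_comm]
    rw [e]
    refine Submodule.sum_mem _ fun i _ => ?_
    split_ifs with h
    · simp
    · refine Submodule.smul_mem _ _ (Submodule.subset_span ⟨d i, h, ?_⟩)
      rw [toLpLin_toLp, ← WithLp.toLp_smul, hS]
      congr 1
      rw [toLin'_apply, mulVec_mulVec, Matrix.mul_assoc, h1, Matrix.mul_one]
      ext v
      simp [mul_diagonal, mul_comm]
  · intro w hw
    have hfix : P *ᵥ w.ofLp = w.ofLp := by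
      induction hw using Submodule.span_induction with
      | mem ψ hψ =>
        obtain ⟨σ, hσ, h⟩ := hψ
        have h' : S *ᵥ ψ.ofLp = σ • ψ.ofLp := by
          have := congrArg WithLp.ofLp h
          simpa using this
        have h2 : σ • (P *ᵥ ψ.ofLp) = σ • ψ.ofLp := by
          rw [← mulVec_smul, ← h', mulVec_mulVec, hPS]
        exact smul_right_injective _ hσ h2
      | zero => simp
      | add a b _ _ ha hb => simp [mulVec_add, ha, hb]
      | smul c a _ ha => simp [mulVec_smul, ha]
    have hsym : P.IsSymm := conj_diagonal_isSymm _ _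
    have : (P *ᵥ x) ⬝ᵥ w.ofLp = x ⬝ᵥ w.ofLp := by
      conv_rhs => rw [← hfix]
      rw [dotProduct_mulVec x, ← mulVec_transpose, hsym.eq]
    rw [inner_sub_left, EuclideanSpace.inner_eq_star_dotProduct,
      EuclideanSpace.inner_eq_star_dotProduct]
    simp only [star_trivial]
    rw [dotProduct_comm _ x, dotProduct_comm _ (P *ᵥ x), this, sub_self]

theorem exists_isSignOf {S : Matrix V V ℝ} (hS : S.IsSymm) : ∃ P G, IsSignOf S P G := by
  obtain ⟨U, d, h1, h2, rfl⟩ := exists_orthogonal_diagonalization hS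
  refine ⟨U * diagonal (fun i => if d i = 0 then (0 : ℝ) else 1) * Uᵀ,
    U * diagonal (fun i => (SignType.sign (d i) : ℝ)) * Uᵀ, conj_diagonal_isSymm _ _,
    conj_diagonal_isSymm _ _, ?_, ?_, ?_, ?_, ?_, ?_, ?_, ?_, ?_, ?_⟩
  · rw [conj_diagonal_mul h1]
    congr 3; ext i; split_ifs with h <;> simp
  · rw [conj_diagonal_mul h1]
    congr 3; ext i
    rcases lt_trichotomy (d i) 0 with h | h | h
    · simp [h, h.ne]
    · simp [h]
    · simp [h, h.ne']
  · rw [conj_diagonal_mul h1]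
    congr 3; ext i; split_ifs with h <;> simp [h]
  · rw [conj_diagonal_mul h1]
    congr 3; ext i; split_ifs with h <;> simp [h]
  · rw [conj_diagonal_mul h1]
    congr 3; ext i; split_ifs with h <;> simp [h]
  · rw [conj_diagonal_mul h1]
    congr 3; ext i; split_ifs with h <;> simp [h]
  · rw [conj_diagonal_mul h1, trace_conj_diagonal h1, nuclearNorm_conj_diagonal h1]
    exact Finset.sum_congr rfl fun i _ => sign_mul_self _
  · have hU : IsUnit U := ⟨⟨U, Uᵀ, h2, h1⟩, rfl⟩
    have hUt : IsUnit Uᵀ := ⟨⟨Uᵀ, U, h1, h2⟩, rfl⟩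
    rw [trace_conj_diagonal h1, rank_mul_eq_left_of_isUnit_det _ _ ((isUnit_iff_isUnit_det _).mp hUt),
      rank_mul_eq_right_of_isUnit_det _ _ ((isUnit_iff_isUnit_det _).mp hU), rank_diagonal,
      Fintype.card_subtype, Finset.card_filter]
    push_cast
    exact Finset.sum_congr rfl fun i _ => by split_ifs <;> simp_all
  · intro a b
    have e : a ⬝ᵥ (U * diagonal (fun i => (SignType.sign (d i) : ℝ)) * Uᵀ) *ᵥ b
        = ∑ i, (SignType.sign (d i) : ℝ) * ((Uᵀ *ᵥ a) i * (Uᵀ *ᵥ b) i) := by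
      rw [← mulVec_mulVec, ← mulVec_mulVec, dotProduct_mulVec, ← mulVec_transpose, dotProduct]
      refine Finset.sum_congr rfl fun i _ => ?_
      rw [mulVec_diagonal]; ring
    rw [e, ← sum_transpose_mulVec_sq h2 a, ← sum_transpose_mulVec_sq h2 b, one_mul,
      ← Finset.sum_add_distrib, Finset.mul_sum]
    refine Finset.sum_le_sum fun i _ => ?_
    rcases lt_trichotomy (d i) 0 with h | h | h
    · simp only [h, sign_neg, SignType.coe_neg_one]
      nlinarith [sq_nonneg ((Uᵀ *ᵥ a) i + (Uᵀ *ᵥ b) i)]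
    · simp only [h, sign_zero, SignType.coe_zero]
      nlinarith [sq_nonneg ((Uᵀ *ᵥ a) i), sq_nonneg ((Uᵀ *ᵥ b) i)]
    · simp only [h, sign_pos, SignType.coe_one]
      nlinarith [sq_nonneg ((Uᵀ *ᵥ a) i - (Uᵀ *ᵥ b) i)]
  · intro x
    rw [projSq, starProjection_supp_eq h1, EuclideanSpace.norm_sq_eq]
    simp [dotProduct, sq]

/-- The sign of the combination is one test matrix of operator norm at most 1 that attains the left
side; duality bounds its pairing with each summand. -/
lemma nuclearNorm_convex {S T : Matrix V V ℝ} (hS : S.IsSymm) (hT : T.IsSymm) {a b : ℝ}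
    (ha : 0 ≤ a) (hb : 0 ≤ b) :
    nuclearNorm (a • S + b • T) ≤ a * nuclearNorm S + b * nuclearNorm T := by
  obtain ⟨P, G, h⟩ := exists_isSignOf ((hS.smul a).add (hT.smul b))
  rw [← h.trace_sign_mul, Matrix.mul_add, trace_add, Matrix.mul_smul, Matrix.mul_smul, trace_smul,
    trace_smul, smul_eq_mul, smul_eq_mul]
  have h1 := trace_transpose_mul_le_nuclearNorm hS h.opNorm_sign
  have h2 := trace_transpose_mul_le_nuclearNorm hT h.opNorm_sign
  rw [h.sign_symm.eq, one_mul] at h1 h2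
  gcongr

lemma IsSignOf.dotProduct_split {S P G : Matrix V V ℝ} (h : IsSignOf S P G) (a : V → ℝ) :
    P *ᵥ a ⬝ᵥ P *ᵥ a + (1 - P) *ᵥ a ⬝ᵥ (1 - P) *ᵥ a = a ⬝ᵥ a := by
  have e : P *ᵥ a ⬝ᵥ P *ᵥ a = a ⬝ᵥ P *ᵥ a := by
    rw [dotProduct_mulVec, ← mulVec_transpose, h.proj_symm.eq, mulVec_mulVec, h.proj_mul_proj,
      dotProduct_comm]
  rw [sub_mulVec, one_mulVec, sub_dotProduct, dotProduct_sub, dotProduct_sub, e,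
    dotProduct_comm (P *ᵥ a) a]
  ring

/-- The subgradient inequality for the nuclear norm. -/
lemma IsSignOf.nuclearNorm_add_le {S P G T : Matrix V V ℝ} (h : IsSignOf S P G) (hS : S.IsSymm)
    (hT : T.IsSymm) :
    nuclearNorm S + (Gᵀ * (T - S)).trace + nuclearNorm ((1 - P) * (T - S) * (1 - P))
      ≤ nuclearNorm T := by
  obtain ⟨Q, hQ⟩ : ∃ Q, Q = 1 - P := ⟨_, rfl⟩
  have hsplit := h.dotProduct_split
  rw [← hQ] at hsplit ⊢
  have hQs : Qᵀ = Q := by rw [hQ, transpose_sub, transpose_one, h.proj_symm.eq]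
  have hQS : Q * S = 0 := by rw [hQ, Matrix.sub_mul, Matrix.one_mul, h.proj_mul, sub_self]
  have hN : (Q * (T - S) * Q).IsSymm := by
    rw [IsSymm, transpose_mul, transpose_mul, transpose_sub, hQs, hT.eq, hS.eq, Matrix.mul_assoc]
  obtain ⟨P', G', h'⟩ := exists_isSignOf hN
  -- The two summands act on L and on its orthogonal complement, so by Pythagoras their sum still
  -- has norm at most 1. Pairing it with T recovers all three terms on the left side.
  have hM : OpNormLE (G + Q * G' * Q) 1 := by
    intro a b
    have e1 : a ⬝ᵥ G *ᵥ b = P *ᵥ a ⬝ᵥ G *ᵥ (P *ᵥ b) := by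
      rw [mulVec_mulVec, h.sign_mul_proj, ← h.proj_symm.eq, mulVec_transpose, ← dotProduct_mulVec,
        mulVec_mulVec, h.proj_mul_sign]
    have e2 : a ⬝ᵥ (Q * G' * Q) *ᵥ b = Q *ᵥ a ⬝ᵥ G' *ᵥ (Q *ᵥ b) := by
      conv_rhs => rw [← hQs, mulVec_transpose, ← dotProduct_mulVec, hQs, mulVec_mulVec, mulVec_mulVec]
    rw [add_mulVec, dotProduct_add, e1, e2, ← hsplit a, ← hsplit b]
    have h1 := h.opNorm_sign (P *ᵥ a) (P *ᵥ b)
    have h2 := h'.opNorm_sign (Q *ᵥ a) (Q *ᵥ b)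
    linarith
  have key := trace_transpose_mul_le_nuclearNorm hT hM
  rw [one_mul] at key
  refine le_trans (le_of_eq ?_) key
  have e3 : ((Q * G' * Q)ᵀ * T).trace = nuclearNorm (Q * (T - S) * Q) := by
    rw [← h'.trace_sign_mul, transpose_mul, transpose_mul, hQs, h'.sign_symm.eq,
      Matrix.mul_sub, hQS, sub_zero, Matrix.mul_assoc, trace_mul_comm]
    simp only [Matrix.mul_assoc]
  rw [transpose_add, Matrix.add_mul, trace_add, e3, ← h.trace_sign_mul, Matrix.mul_sub, trace_sub,
    h.sign_symm.eq]
  ring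

end Nuclear

/-! ### The basic inequality and the deterministic error bound. -/

section Oracle

open Matrix

lemma frobSq_eq_trace {ι κ : Type*} [Fintype ι] [Fintype κ] (M : Matrix ι κ ℝ) :
    frobSq M = (Mᵀ * M).trace := by
  rw [trace_transpose_mul_eq_sum]; simp [frobSq, sq]

lemma frobSq_nonneg {ι κ : Type*} [Fintype ι] [Fintype κ] (M : Matrix ι κ ℝ) : 0 ≤ frobSq M :=
  Finset.sum_nonneg fun _ _ => Finset.sum_nonneg fun _ _ => sq_nonneg _

lemma frobSq_transpose {ι κ : Type*} [Fintype ι] [Fintype κ] (M : Matrix ι κ ℝ) :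
    frobSq Mᵀ = frobSq M := by
  simp only [frobSq, transpose_apply]; exact Finset.sum_comm

lemma frobSq_eq_sum_col {ι κ : Type*} [Fintype ι] [Fintype κ] (M : Matrix ι κ ℝ) :
    frobSq M = ∑ k, (fun i => M i k) ⬝ᵥ fun i => M i k := by
  rw [frobSq, Finset.sum_comm]; simp [dotProduct, sq]

/-- The weights are balanced so that the last term becomes a quarter of the squared norm to be
absorbed. -/
lemma mul_trace_transpose_mul_le {ι κ : Type*} [Fintype ι] [Fintype κ] (X Y : Matrix ι κ ℝ)
    (c : ℝ) {m : ℝ} (hm : 0 < m) :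
    c * (Xᵀ * Y).trace ≤ c ^ 2 * m ^ 2 * frobSq X + frobSq Y / (4 * m ^ 2) := by
  have h := (mul_le_mul_of_nonneg_left (le_abs_self _) two_pos.le).trans
    (two_mul_abs_trace_transpose_mul_le ((c * m) • X) ((1 / (2 * m)) • Y))
  simp only [transpose_smul, Matrix.smul_mul, Matrix.mul_smul, trace_smul, smul_eq_mul,
    ← frobSq_eq_trace] at h
  have e1 : 2 * (c * m * (1 / (2 * m) * (Xᵀ * Y).trace)) = c * (Xᵀ * Y).trace := by field_simp
  have e2 : 1 / (2 * m) * (1 / (2 * m) * frobSq Y) = frobSq Y / (4 * m ^ 2) := by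
    field_simp; ring
  rw [mul_left_comm (1 / (2 * m)) (c * m)] at h
  nlinarith [h, e1, e2]

variable {V : Type*} [Fintype V]

lemma l2Sq_eq (S : Matrix V V ℝ) : l2Sq S = frobSq S / (Fintype.card V : ℝ) ^ 2 := rfl

lemma l2Sq_nonneg (S : Matrix V V ℝ) : 0 ≤ l2Sq S := by
  rw [l2Sq_eq]; exact div_nonneg (frobSq_nonneg S) (sq_nonneg _)

lemma l2Sq_convex (S T : Matrix V V ℝ) (a : ℝ) :
    l2Sq ((1 - a) • S + a • T) = (1 - a) * l2Sq S + a * l2Sq T - a * (1 - a) * l2Sq (S - T) := by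
  simp only [l2Sq, mul_div_assoc', ← add_div, ← sub_div]
  congr 1
  simp only [Finset.mul_sum, ← Finset.sum_add_distrib, ← Finset.sum_sub_distrib]
  refine Finset.sum_congr rfl fun u _ => Finset.sum_congr rfl fun v _ => ?_
  simp only [Matrix.add_apply, Matrix.sub_apply, Matrix.smul_apply, smul_eq_mul]
  ring

variable [DecidableEq V]

lemma l2Sq_sqrt_mul {W : Matrix V V ℝ} (hW : W.PosSemidef) (S : Matrix V V ℝ) :
    l2Sq (CFC.sqrt W * S) = (Sᵀ * W * S).trace / (Fintype.card V : ℝ) ^ 2 := by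
  have hs : (CFC.sqrt W)ᵀ = CFC.sqrt W := by
    have := (CFC.sqrt_nonneg W).posSemidef.1
    rwa [IsHermitian, conjTranspose_eq_transpose_of_trivial] at this
  rw [l2Sq_eq, frobSq_eq_trace, transpose_mul, hs, Matrix.mul_assoc, ← Matrix.mul_assoc (CFC.sqrt W),
    CFC.sqrt_mul_sqrt_self W hW.nonneg, ← Matrix.mul_assoc]

/-- The empirical linear functional splits into its mean and the noise. -/
lemma sum_sign_mul_eq {n : ℕ} (hn : 0 < n) (Sstar S : Matrix V V ℝ) (x : Fin n → V × V × Bool) :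
    2 / (n : ℝ) * ∑ j, signOf (x j).2.2 * S (x j).1 (x j).2.1
      = 2 / n * ((noise Sstar x)ᵀ * S).trace
        + 2 * (Sstarᵀ * S).trace / (Fintype.card V : ℝ) ^ 2 := by
  have hn' : (n : ℝ) ≠ 0 := by positivity
  have e : ((noise Sstar x)ᵀ * S).trace = ∑ j, signOf (x j).2.2 * S (x j).1 (x j).2.1
      - n * ((Sstarᵀ * S).trace / (Fintype.card V : ℝ) ^ 2) := by
    have h1 (u v : V) : ((Matrix.single u v (1 : ℝ))ᵀ * S).trace = S u v := by
      rw [transpose_single, trace_single_mul]; simp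
    rw [noise, transpose_sum, Matrix.sum_mul, trace_sum]
    simp only [transpose_sub, transpose_smul, Matrix.sub_mul, Matrix.smul_mul, trace_sub,
      trace_smul, h1]
    simp only [Finset.sum_sub_distrib, Finset.sum_const, Finset.card_univ, Fintype.card_fin,
      nsmul_eq_mul, smul_eq_mul]
    ring
  rw [e]
  field_simp
  ring

/-- The basic inequality for the penalized least squares estimator. -/
lemma basic_inequality {n : ℕ} (hn : 0 < n) {W Sstar T : Matrix V V ℝ} {ε εbar : ℝ} (hε : 0 ≤ ε)
    {D : Set (Matrix V V ℝ)} (hD : Convex ℝ D) (hDs : ∀ S ∈ D, S.IsSymm)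
    (hS : Sstar ∈ D) (hT : T ∈ D) (x : Fin n → V × V × Bool)
    (hmin : IsMinOn (risk W ε εbar (fun j => (x j).1) (fun j => (x j).2.1)
      (fun j => signOf (x j).2.2)) D T) :
    2 * l2Sq (T - Sstar) + εbar * l2Sq (CFC.sqrt W * (T - Sstar))
        + εbar * l2Sq (CFC.sqrt W * T)
      ≤ 2 / n * ((noise Sstar x)ᵀ * (T - Sstar)).trace + ε * (nuclearNorm Sstar - nuclearNorm T)
        + εbar * l2Sq (CFC.sqrt W * Sstar) := by
  set F := risk W ε εbar (fun j => (x j).1) (fun j => (x j).2.1) (fun j => signOf (x j).2.2) with hF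
  set q := l2Sq (T - Sstar) + εbar * l2Sq (CFC.sqrt W * (T - Sstar)) with hq
  -- Compare Ŝ with a point of the segment towards S⋆. Strong convexity gains a(1 - a)q; dividing by
  -- a and letting a → 0 leaves the full q.
  have hconv (a : ℝ) (ha0 : 0 < a) (ha1 : a < 1) : F T + (1 - a) * q ≤ F Sstar := by
    have hmem : (1 - a) • T + a • Sstar ∈ D := hD hT hS (by linarith) ha0.le (by ring)
    have h1 : F T ≤ F ((1 - a) • T + a • Sstar) := hmin hmem
    have h2 : F ((1 - a) • T + a • Sstar) ≤ (1 - a) * F T + a * F Sstar - a * (1 - a) * q := by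
      have hn1 := mul_le_mul_of_nonneg_left (nuclearNorm_convex (hDs T hT) (hDs Sstar hS)
        (a := 1 - a) (b := a) (by linarith) ha0.le) hε
      have e2 : CFC.sqrt W * ((1 - a) • T + a • Sstar)
          = (1 - a) • (CFC.sqrt W * T) + a • (CFC.sqrt W * Sstar) := by
        rw [Matrix.mul_add, Matrix.mul_smul, Matrix.mul_smul]
      have e3 : ∑ j, signOf (x j).2.2 * ((1 - a) • T + a • Sstar) (x j).1 (x j).2.1
          = (1 - a) * ∑ j, signOf (x j).2.2 * T (x j).1 (x j).2.1
            + a * ∑ j, signOf (x j).2.2 * Sstar (x j).1 (x j).2.1 := by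
        rw [Finset.mul_sum, Finset.mul_sum, ← Finset.sum_add_distrib]
        refine Finset.sum_congr rfl fun j _ => ?_
        simp only [Matrix.add_apply, Matrix.smul_apply, smul_eq_mul]
        ring
      simp only [hF, risk]
      rw [e2, e3, l2Sq_convex, l2Sq_convex, hq, Matrix.mul_sub]
      linarith
    have h3 : a * (F T + (1 - a) * q) ≤ a * F Sstar := by linarith
    exact le_of_mul_le_mul_left h3 ha0
  have hlim : F T + q ≤ F Sstar := by
    have ht : Filter.Tendsto (fun a : ℝ => F T + (1 - a) * q) (nhdsWithin 0 (Set.Ioi 0))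
        (nhds (F T + (1 - 0) * q)) :=
      (Continuous.tendsto (by fun_prop) 0).mono_left nhdsWithin_le_nhds
    rw [sub_zero, one_mul] at ht
    refine le_of_tendsto ht ?_
    filter_upwards [Ioo_mem_nhdsGT (show (0 : ℝ) < 1 by norm_num)] with a ha
    exact hconv a ha.1 ha.2
  have h1 := sum_sign_mul_eq hn Sstar T x
  have h2 := sum_sign_mul_eq hn Sstar Sstar x
  -- The excess of the expected quadratic risk is exactly ‖Δ‖². Together with the copy inside q this
  -- accounts for the factor 2.
  have h3 : l2Sq Sstar - l2Sq T = - l2Sq (T - Sstar)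
      - 2 * ((Sstarᵀ * T).trace - (Sstarᵀ * Sstar).trace) / (Fintype.card V : ℝ) ^ 2 := by
    simp only [l2Sq_eq, frobSq_eq_trace]
    have : (Tᵀ * Sstar).trace = (Sstarᵀ * T).trace := by
      rw [← trace_transpose, transpose_mul, transpose_transpose]
    simp only [transpose_sub, Matrix.sub_mul, Matrix.mul_sub, trace_sub, this]
    ring
  simp only [hF, risk] at hlim
  rw [h1, h2] at hlim
  rw [Matrix.mul_sub (noise Sstar x)ᵀ, trace_sub]
  simp only [hq] at hlim
  have h4 : 2 * ((Sstarᵀ * T).trace - (Sstarᵀ * Sstar).trace) / (Fintype.card V : ℝ) ^ 2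
    = 2 * (Sstarᵀ * T).trace / (Fintype.card V : ℝ) ^ 2
      - 2 * (Sstarᵀ * Sstar).trace / (Fintype.card V : ℝ) ^ 2 := by ring
  linarith

/-- The deterministic part of the error bound. -/
lemma oracle_inequality [Nonempty V] {κ : Type*} [Fintype κ] {n : ℕ} (hn : 0 < n)
    {W Sstar T P G N : Matrix V V ℝ} {ε εbar y : ℝ} (hε : 0 ≤ ε) (hεb : 0 ≤ εbar)
    (hW : W.PosSemidef) (hS : Sstar.IsSymm) (hT : T.IsSymm) (h : IsSignOf Sstar P G)
    {C C' : Matrix V κ ℝ} (hCC' : C * C'ᵀ = 1) (hC' : C' * C'ᵀ = 1 + εbar • W)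
    (hN : OpNormLE N y) (hy : 2 / n * y = ε)
    (hbasic : 2 * l2Sq (T - Sstar) + εbar * l2Sq (CFC.sqrt W * (T - Sstar))
        + εbar * l2Sq (CFC.sqrt W * T)
      ≤ 2 / n * (Nᵀ * (T - Sstar)).trace + ε * (nuclearNorm Sstar - nuclearNorm T)
        + εbar * l2Sq (CFC.sqrt W * Sstar)) :
    l2Sq (T - Sstar) ≤ ε ^ 2 * (Fintype.card V : ℝ) ^ 2 * frobSq (G * C)
      + (2 / n) ^ 2 * (Fintype.card V : ℝ) ^ 2
        * (frobSq (P * N * C) + frobSq (Cᵀ * (1 - P) * N * P))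
      + εbar * l2Sq (CFC.sqrt W * Sstar) := by
  have hm : (0 : ℝ) < Fintype.card V := by exact_mod_cast Fintype.card_pos
  obtain ⟨Δ, hΔ⟩ : ∃ Δ, Δ = T - Sstar := ⟨_, rfl⟩
  obtain ⟨Q, hQ⟩ : ∃ Q, Q = 1 - P := ⟨_, rfl⟩
  have hsub := h.nuclearNorm_add_le hS hT
  rw [← hΔ] at hbasic hsub ⊢
  rw [← hQ] at hsub ⊢
  have hΔs : Δᵀ = Δ := by rw [hΔ, transpose_sub, hT.eq, hS.eq]
  have hQs : Qᵀ = Q := by rw [hQ, transpose_sub, transpose_one, h.proj_symm.eq]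
  have hnorm : frobSq (Δ * C') / (4 * (Fintype.card V : ℝ) ^ 2)
      = (l2Sq Δ + εbar * l2Sq (CFC.sqrt W * Δ)) / 4 := by
    rw [l2Sq_sqrt_mul hW, l2Sq_eq, frobSq_eq_trace, frobSq_eq_trace, transpose_mul,
      Matrix.mul_assoc, trace_mul_comm, show Δᵀ * (Δ * C') * C'ᵀ = Δᵀ * Δ * (C' * C'ᵀ) by
        simp only [Matrix.mul_assoc], hC', Matrix.mul_add, Matrix.mul_one, trace_add,
      Matrix.mul_smul, trace_smul, smul_eq_mul, hΔs, Matrix.mul_assoc Δ W Δ, trace_mul_comm Δ (W * Δ),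
      Matrix.mul_assoc W, trace_mul_comm W]
    field_simp
  -- Inserting C C'ᵀ = 1 moves the weight onto M. As Δ is symmetric, the weight may be inserted on
  -- either side: on the right for G and PN, on the left for QNP, so that P always keeps the
  -- opposite side.
  have hright (M : Matrix V V ℝ) : ((M * C)ᵀ * (Δ * C')).trace = (Mᵀ * Δ).trace := by
    rw [transpose_mul, Matrix.mul_assoc, trace_mul_comm, show Mᵀ * (Δ * C') * Cᵀ
      = Mᵀ * Δ * (C * C'ᵀ)ᵀ by rw [transpose_mul, transpose_transpose]; simp only [Matrix.mul_assoc],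
      hCC', transpose_one, Matrix.mul_one]
  have hleft (M : Matrix V V ℝ) : ((Cᵀ * M)ᵀ * (Δ * C')ᵀ).trace = (Mᵀ * Δ).trace := by
    rw [transpose_mul, transpose_mul, transpose_transpose, hΔs, Matrix.mul_assoc,
      ← Matrix.mul_assoc C, hCC', Matrix.one_mul]
  -- Each of the three pairings costs a quarter of ‖Δ‖² + ε̄‖W^{1/2}Δ‖². The left side of the basic
  -- inequality can spare three quarters and still retain ‖Δ‖².
  have h1 := mul_trace_transpose_mul_le (G * C) (Δ * C') (-ε) hm
  have h2 := mul_trace_transpose_mul_le (P * N * C) (Δ * C') (2 / n) hm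
  have h3 := mul_trace_transpose_mul_le (Cᵀ * (Q * N * P)) (Δ * C')ᵀ (2 / n) hm
  rw [hright, hnorm] at h1 h2
  rw [hleft, frobSq_transpose (Δ * C'), hnorm] at h3
  have hsplit : (Nᵀ * Δ).trace = (Nᵀ * (Q * Δ * Q)).trace + ((P * N)ᵀ * Δ).trace
      + ((Q * N * P)ᵀ * Δ).trace := by
    have e0 : N = Q * N * Q + P * N + Q * N * P := by
      rw [hQ]; noncomm_ring
    have e1 : (Nᵀ * (Q * Δ * Q)).trace = ((Q * N * Q)ᵀ * Δ).trace := by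
      rw [transpose_mul, transpose_mul, hQs, ← Matrix.mul_assoc, trace_mul_comm]
      simp only [Matrix.mul_assoc]
    rw [e1, ← trace_add, ← trace_add, ← Matrix.add_mul, ← Matrix.add_mul, ← transpose_add,
      ← transpose_add, ← e0]
  have hQΔQ : (Q * Δ * Q).IsSymm := by
    rw [IsSymm, transpose_mul, transpose_mul, hQs, hΔs, Matrix.mul_assoc]
  have h4 := mul_le_mul_of_nonneg_left (trace_transpose_mul_le_nuclearNorm hQΔQ hN)
    (show (0 : ℝ) ≤ 2 / n by positivity)
  rw [← mul_assoc (2 / (n : ℝ)) y, hy] at h4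
  have h5 := mul_le_mul_of_nonneg_left hsub hε
  have h6 := mul_nonneg hεb (l2Sq_nonneg (CFC.sqrt W * T))
  have h7 := mul_nonneg hεb (l2Sq_nonneg (CFC.sqrt W * Δ))
  have h8 := l2Sq_nonneg Δ
  rw [hsplit] at hbasic
  rw [show Cᵀ * Q * N * P = Cᵀ * (Q * N * P) by simp only [Matrix.mul_assoc]]
  rw [neg_sq] at h1
  rw [mul_add (2 / (n : ℝ)), mul_add (2 / (n : ℝ))] at hbasic
  rw [mul_add ((2 / (n : ℝ)) ^ 2 * (Fintype.card V : ℝ) ^ 2)]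
  linarith

end Oracle

/-! ### Effective dimension and the weights built from W. -/

section Spectrum

open Matrix

/-- Abel summation: the partial sums of p - B are nonpositive, so replacing a weight by a smaller
later one only increases the weighted sum. Nonnegativity of the last weight concludes. -/
lemma sum_mul_le_of_partial_sums {w p : ℕ → ℝ} {B : ℝ} {m : ℕ}
    (hw0 : ∀ k ∈ Finset.Icc 1 m, 0 ≤ w k)
    (hw : ∀ k, 1 ≤ k → k + 1 ≤ m → w (k + 1) ≤ w k)
    (hp : ∀ k ∈ Finset.Icc 1 m, ∑ j ∈ Finset.Icc 1 k, p j ≤ B * k) :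
    ∑ k ∈ Finset.Icc 1 m, w k * p k ≤ B * ∑ k ∈ Finset.Icc 1 m, w k := by
  have hD (k : ℕ) (hk : k ∈ Finset.Icc 1 m) : ∑ j ∈ Finset.Icc 1 k, (p j - B) ≤ 0 := by
    have := hp k hk
    simp only [Finset.sum_sub_distrib, Finset.sum_const, Nat.card_Icc, add_tsub_cancel_right,
      nsmul_eq_mul]
    linarith
  have key (M : ℕ) (h1 : 1 ≤ M) : M ≤ m → ∑ k ∈ Finset.Icc 1 M, w k * (p k - B)
      ≤ w M * ∑ k ∈ Finset.Icc 1 M, (p k - B) := by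
    induction M, h1 using Nat.le_induction with
    | base => simp
    | succ M h1 ih =>
      intro hM
      rw [Finset.sum_Icc_succ_top (by omega), Finset.sum_Icc_succ_top (by omega), mul_add]
      have h2 := ih (by omega)
      have h3 := mul_le_mul_of_nonpos_right (hw M h1 hM)
        (hD M (Finset.mem_Icc.mpr ⟨h1, by omega⟩))
      linarith
  rcases Nat.eq_zero_or_pos m with rfl | hm
  · simp
  have h1 := key m hm le_rfl
  have hmem : m ∈ Finset.Icc 1 m := Finset.mem_Icc.mpr ⟨hm, le_rfl⟩
  have h2 := mul_nonpos_of_nonneg_of_nonpos (hw0 m hmem) (hD m hmem)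
  have h3 : ∑ k ∈ Finset.Icc 1 m, w k * (p k - B)
      = ∑ k ∈ Finset.Icc 1 m, w k * p k - B * ∑ k ∈ Finset.Icc 1 m, w k := by
    rw [Finset.mul_sum, ← Finset.sum_sub_distrib]
    exact Finset.sum_congr rfl fun k _ => by ring
  linarith

/-- The effective dimension at regularization level `ε̄ > λ_s⁻¹` is of order `s`. -/
lemma sum_inv_one_add_le {m : ℕ} {lam : ℕ → ℝ} {k₀ : ℕ} {ζ c εbar : ℝ} (hc : 0 < c)
    (hlam : ∀ k ∈ Finset.Icc 1 m, 0 ≤ lam k)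
    (hmono : ∀ k ∈ Finset.Icc 1 m, ∀ l ∈ Finset.Icc 1 m, k ≤ l → lam k ≤ lam l)
    (h : SpectrumCondition m lam k₀ ζ c) {s : ℕ} (hs : s ∈ Finset.Icc (k₀ + 1) (m + 1))
    (hε : invEig m lam s < εbar) :
    ∑ k ∈ Finset.Icc 1 m, 1 / (1 + εbar * lam k) ≤ (1 + c) * s := by
  obtain ⟨hs1, hs2⟩ := Finset.mem_Icc.mp hs
  obtain ⟨⟨hk₀, hk₀p⟩, -⟩ := h.isLeast
  obtain ⟨hk1, hk2⟩ := Finset.mem_Icc.mp hk₀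
  have hεb : 0 ≤ εbar := by
    refine le_trans ?_ hε.le
    rw [invEig]
    split_ifs with hsm
    · exact inv_nonneg.mpr (hlam s (Finset.mem_Icc.mpr ⟨by omega, hsm⟩))
    · exact le_rfl
  have hle1 (k : ℕ) (hk : k ∈ Finset.Icc 1 m) : 1 / (1 + εbar * lam k) ≤ 1 := by
    have := mul_nonneg hεb (hlam k hk)
    rw [div_le_one (by linarith)]; linarith
  -- For s ≤ m, indices below s contribute at most 1 each; from s on, ε̄λ_s ≥ 1 gives 1/(1 + ε̄λ_k)
  -- ≤ λ_s/λ_k, and the tail condition sums these to at most cs. For s = m + 1 the trivial bound m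
  -- suffices.
  by_cases hsm : s ≤ m
  · have hsp : 0 < lam s :=
      lt_of_lt_of_le hk₀p (hmono _ hk₀ _ (Finset.mem_Icc.mpr ⟨by omega, hsm⟩) (by omega))
    rw [invEig, if_pos hsm] at hε
    have hεs : 1 ≤ εbar * lam s := by
      have := mul_lt_mul_of_pos_right hε hsp
      rw [inv_mul_cancel₀ hsp.ne'] at this
      exact this.le
    have hsplit : ∑ k ∈ Finset.Icc 1 m, 1 / (1 + εbar * lam k)
        = ∑ k ∈ Finset.Ico 1 s, 1 / (1 + εbar * lam k)
          + ∑ k ∈ Finset.Icc s m, 1 / (1 + εbar * lam k) := by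
      have e1 : Finset.Icc 1 m = Finset.Ico 1 (m + 1) := by ext; simp
      have e2 : Finset.Icc s m = Finset.Ico s (m + 1) := by ext; simp
      rw [e1, e2, Finset.sum_Ico_consecutive _ (by omega) (by omega)]
    have hA : ∑ k ∈ Finset.Ico 1 s, 1 / (1 + εbar * lam k) ≤ s := by
      refine (Finset.sum_le_card_nsmul _ _ 1 fun k hk => hle1 k ?_).trans ?_
      · have := Finset.mem_Ico.mp hk
        exact Finset.mem_Icc.mpr ⟨this.1, by omega⟩
      · simp
    have hB : ∑ k ∈ Finset.Icc s m, 1 / (1 + εbar * lam k) ≤ c * s := by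
      calc _ ≤ ∑ k ∈ Finset.Icc s m, lam s * (1 / lam k) := by
            refine Finset.sum_le_sum fun k hk => ?_
            obtain ⟨hk3, hk4⟩ := Finset.mem_Icc.mp hk
            have hkp : 0 < lam k := lt_of_lt_of_le hsp (hmono _ (Finset.mem_Icc.mpr ⟨by omega, hsm⟩)
              _ (Finset.mem_Icc.mpr ⟨by omega, hk4⟩) hk3)
            rw [mul_one_div, div_le_div_iff₀ (by positivity) hkp]
            nlinarith
        _ = lam s * ∑ k ∈ Finset.Icc s m, 1 / lam k := by rw [Finset.mul_sum]
        _ ≤ lam s * (c * (s / lam s)) := by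
            gcongr
            exact h.tail s (by omega) hsm
        _ = c * s := by field_simp
    rw [hsplit]
    linarith
  · have : s = m + 1 := by omega
    refine (Finset.sum_le_card_nsmul _ _ 1 fun k hk => hle1 k hk).trans ?_
    rw [this]
    simp only [Nat.card_Icc, add_tsub_cancel_right, nsmul_eq_mul, mul_one]
    push_cast
    have : 0 ≤ c * ((m : ℝ) + 1) := by positivity
    linarith

/-- The matrix with columns `φ_1, …, φ_m`. -/
def eigenMatrix {V : Type*} [Fintype V] (phi : ℕ → EuclideanSpace ℝ V) :
    Matrix V (Finset.Icc 1 (Fintype.card V)) ℝ :=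
  of fun v k => phi k v

variable {V : Type*} [Fintype V] {W : Matrix V V ℝ} {lam : ℕ → ℝ}
  {phi : ℕ → EuclideanSpace ℝ V}

lemma IsSpectralRepr.transpose_mul_self (h : IsSpectralRepr W lam phi) :
    (eigenMatrix phi)ᵀ * eigenMatrix phi = 1 := by
  ext k l
  have := (orthonormal_iff_ite.mp h.orthonormal) l k
  rw [EuclideanSpace.inner_eq_star_dotProduct] at this
  rw [mul_apply, one_apply]
  simp only [star_trivial] at this
  rw [dotProduct] at this
  simp only [eigenMatrix, transpose_apply, of_apply]
  rw [this]
  simp only [eq_comm]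

lemma IsSpectralRepr.eq_mul_diagonal (h : IsSpectralRepr W lam phi) :
    W = eigenMatrix phi * diagonal (fun k : Finset.Icc 1 (Fintype.card V) => lam k)
      * (eigenMatrix phi)ᵀ := by
  rw [h.eq_sum, ← Finset.sum_coe_sort]
  ext u v
  rw [mul_apply]
  simp only [Matrix.sum_apply, Matrix.smul_apply, vecMulVec_apply, smul_eq_mul, mul_diagonal,
    eigenMatrix, of_apply, transpose_apply]
  exact Finset.sum_congr rfl fun k _ => by ring

lemma IsSpectralRepr.posSemidef (h : IsSpectralRepr W lam phi) : W.PosSemidef := by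
  rw [h.eq_mul_diagonal]
  have := (PosSemidef.diagonal (n := Finset.Icc 1 (Fintype.card V)) (d := fun k => lam k)
    fun k => h.nonneg k k.2).mul_mul_conjTranspose_same (eigenMatrix phi)
  rwa [conjTranspose_eq_transpose_of_trivial] at this

variable [DecidableEq V]

lemma IsSpectralRepr.mul_transpose_self (h : IsSpectralRepr W lam phi) :
    eigenMatrix phi * (eigenMatrix phi)ᵀ = 1 :=
  (mul_eq_one_comm_of_card_eq _ _ _ (by simp)).mp h.transpose_mul_self

/-- Factors of `(1 + ε̄ W)⁻¹` and of `1 + ε̄ W` that are inverse to each other. -/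
theorem IsSpectralRepr.exists_weight_factors (h : IsSpectralRepr W lam phi) {εbar : ℝ}
    (hε : 0 ≤ εbar) :
    ∃ C C' : Matrix V (Finset.Icc 1 (Fintype.card V)) ℝ,
      C * C'ᵀ = 1 ∧ C' * C'ᵀ = 1 + εbar • W ∧
      (∀ P : Matrix V V ℝ, frobSq (P * C) = ∑ k ∈ Finset.Icc 1 (Fintype.card V),
        1 / (1 + εbar * lam k) * (P *ᵥ (phi k).ofLp ⬝ᵥ P *ᵥ (phi k).ofLp)) ∧
      frobSq C = ∑ k ∈ Finset.Icc 1 (Fintype.card V), 1 / (1 + εbar * lam k) ∧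
      ∀ x, Cᵀ *ᵥ x ⬝ᵥ Cᵀ *ᵥ x ≤ x ⬝ᵥ x := by
  set Φ := eigenMatrix phi with hΦ
  have h1 : Φᵀ * Φ = 1 := h.transpose_mul_self
  have h2 : Φ * Φᵀ = 1 := h.mul_transpose_self
  let g : Finset.Icc 1 (Fintype.card V) → ℝ := fun k => 1 + εbar * lam k
  have hg (k : Finset.Icc 1 (Fintype.card V)) : 1 ≤ g k := by
    have := mul_nonneg hε (h.nonneg k k.2)
    simp only [g]; linarith
  have hsq (k : Finset.Icc 1 (Fintype.card V)) : Real.sqrt (g k) ^ 2 = g k :=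
    Real.sq_sqrt (by linarith [hg k])
  have hpos (k : Finset.Icc 1 (Fintype.card V)) : 0 < Real.sqrt (g k) :=
    Real.sqrt_pos.mpr (by linarith [hg k])
  have hcol (P : Matrix V V ℝ) : frobSq (P * (Φ * diagonal fun k => 1 / Real.sqrt (g k)))
      = ∑ k ∈ Finset.Icc 1 (Fintype.card V),
        1 / (1 + εbar * lam k) * (P *ᵥ (phi k).ofLp ⬝ᵥ P *ᵥ (phi k).ofLp) := by
    rw [← Finset.sum_coe_sort, frobSq_eq_sum_col]
    refine Finset.sum_congr rfl fun k _ => ?_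
    have e : (fun i => (P * (Φ * diagonal fun k => 1 / Real.sqrt (g k))) i k)
        = (1 / Real.sqrt (g k)) • (P *ᵥ (phi k).ofLp) := by
      ext i
      rw [← Matrix.mul_assoc, mul_diagonal, Pi.smul_apply, smul_eq_mul, mul_comm]
      rfl
    rw [e, dotProduct_smul, smul_dotProduct, smul_eq_mul, smul_eq_mul, ← mul_assoc, ← sq, div_pow,
      hsq, one_pow]
  refine ⟨Φ * diagonal fun k => 1 / Real.sqrt (g k), Φ * diagonal fun k => Real.sqrt (g k),
    ?_, ?_, hcol, ?_, ?_⟩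
  · rw [transpose_mul, diagonal_transpose, Matrix.mul_assoc, ← Matrix.mul_assoc (diagonal _),
      diagonal_mul_diagonal]
    have e : (fun i => 1 / Real.sqrt (g i) * Real.sqrt (g i)) = fun _ => 1 := by
      ext i; exact one_div_mul_cancel (hpos i).ne'
    rw [e, diagonal_one, Matrix.one_mul, h2]
  · rw [transpose_mul, diagonal_transpose, Matrix.mul_assoc, ← Matrix.mul_assoc (diagonal _),
      diagonal_mul_diagonal]
    have e : diagonal (fun i => Real.sqrt (g i) * Real.sqrt (g i))
        = 1 + εbar • diagonal (fun k : Finset.Icc 1 (Fintype.card V) => lam k) := by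
      simp only [← sq, hsq, g]
      ext i j
      by_cases hij : i = j
      · subst hij; simp
      · simp [hij]
    rw [e, Matrix.add_mul, Matrix.mul_add, Matrix.one_mul, h2, Matrix.smul_mul, Matrix.mul_smul,
      ← Matrix.mul_assoc]
    conv_rhs => rw [h.eq_mul_diagonal]
  · have := hcol 1
    rw [Matrix.one_mul] at this
    rw [this]
    refine Finset.sum_congr rfl fun k hk => ?_
    have hn := h.orthonormal.1 ⟨k, hk⟩
    have : (phi k).ofLp ⬝ᵥ (phi k).ofLp = 1 := by
      have h3 := EuclideanSpace.norm_sq_eq (phi k)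
      rw [show ‖phi k‖ = 1 from hn] at h3
      simpa [dotProduct, sq] using h3.symm
    rw [one_mulVec, this, mul_one]
  · intro x
    have e : x ⬝ᵥ x = Φᵀ *ᵥ x ⬝ᵥ Φᵀ *ᵥ x := by
      rw [dotProduct_mulVec, ← mulVec_transpose, transpose_transpose, mulVec_mulVec, h2, one_mulVec]
    rw [e, transpose_mul, diagonal_transpose, ← mulVec_mulVec]
    refine Finset.sum_le_sum fun k _ => ?_
    rw [mulVec_diagonal]
    have h3 : (1 / Real.sqrt (g k)) ^ 2 ≤ 1 := by
      rw [div_pow, hsq, one_pow, div_le_one (by linarith [hg k])]; exact hg k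
    nlinarith [mul_le_mul_of_nonneg_right h3 (mul_self_nonneg ((Φᵀ *ᵥ x) k))]

end Spectrum

/-! ### The joint law of the observations. -/

section Sample

variable {V : Type*} [MeasurableSpace V] {Ω : Type*} [MeasurableSpace Ω] {μ : Measure Ω} {n : ℕ}
  {Sstar : Matrix V V ℝ} {X X' : Fin n → Ω → V} {Y : Fin n → Ω → ℝ}

/-- The observations with the labels coded by Booleans. -/
def observation (X X' : Fin n → Ω → V) (Y : Fin n → Ω → ℝ) (ω : Ω) (j : Fin n) : V × V × Bool :=
  (X j ω, X' j ω, decide (Y j ω = 1))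

lemma IsSample.signOf_decide (h : IsSample μ Sstar X X' Y) (j : Fin n) (ω : Ω) :
    signOf (decide (Y j ω = 1)) = Y j ω := by
  rcases h.label j ω with h | h <;> rw [h] <;> norm_num [signOf]

lemma IsSample.measurable_observation (h : IsSample μ Sstar X X' Y) (j : Fin n) :
    Measurable fun ω => observation X X' Y ω j := by
  have h1 : Measurable fun ω => decide (Y j ω = 1) := by
    refine measurable_to_bool ?_
    have : (fun ω => decide (Y j ω = 1)) ⁻¹' {true} = Y j ⁻¹' {1} := by ext; simp
    rw [this]
    exact h.measurable_label j (measurableSet_singleton 1)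
  exact (h.measurable_fst j).prodMk ((h.measurable_snd j).prodMk h1)

variable [Fintype V] [MeasurableSingletonClass V]

lemma IsSample.measureReal_pair (h : IsSample μ Sstar X X' Y) (j : Fin n) (u v : V) :
    μ.real (X j ⁻¹' {u} ∩ X' j ⁻¹' {v}) = 1 / (Fintype.card V : ℝ) ^ 2 := by
  have hu (Z : Ω → V) (hZ : HasLaw Z (uniformOn Set.univ) μ) (u : V) :
      μ.real (Z ⁻¹' {u}) = 1 / Fintype.card V := by
    have h1 : μ.real (Z ⁻¹' {u}) = (uniformOn (Set.univ : Set V)).real {u} := by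
      rw [← hZ.map_eq, map_measureReal_apply_of_aemeasurable hZ.aemeasurable (measurableSet_singleton u)]
    rw [h1, measureReal_def, uniformOn_univ, Measure.count_singleton]
    simp
  have h2 := (h.indep_pair j).measure_inter_preimage_eq_mul {u} {v} (measurableSet_singleton u)
    (measurableSet_singleton v)
  rw [measureReal_def, h2, ENNReal.toReal_mul, ← measureReal_def, ← measureReal_def,
    hu _ (h.law_fst j), hu _ (h.law_snd j)]
  ring

variable [IsProbabilityMeasure μ]

/-- A label in {-1, 1} is 2·1_A - 1, so its conditional mean determines its conditional law. -/
lemma IsSample.measureReal_observation [Nonempty V] (h : IsSample μ Sstar X X' Y) (j : Fin n)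
    (t : V × V × Bool) : μ.real {ω | observation X X' Y ω j = t} = obsWeight Sstar t := by
  obtain ⟨u, v, b⟩ := t
  have hm : (Fintype.card V : ℝ) ≠ 0 := by exact_mod_cast Fintype.card_ne_zero
  set E := X j ⁻¹' {u} ∩ X' j ⁻¹' {v} with hE
  have hEm : MeasurableSet E := (h.measurable_fst j (measurableSet_singleton u)).inter
    (h.measurable_snd j (measurableSet_singleton v))
  have hEμ : μ.real E = 1 / (Fintype.card V : ℝ) ^ 2 := h.measureReal_pair j u v
  set A := Y j ⁻¹' {1} with hA
  have hAm : MeasurableSet A := h.measurable_label j (measurableSet_singleton 1)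
  have hE0 : μ E ≠ 0 := by
    intro h0
    rw [measureReal_def, h0, ENNReal.toReal_zero] at hEμ
    have : 1 / (Fintype.card V : ℝ) ^ 2 ≠ 0 := by positivity
    exact this hEμ.symm
  have : IsProbabilityMeasure (μ[|E]) := cond_isProbabilityMeasure hE0
  have hY : Y j = fun ω => 2 * A.indicator (fun _ => (1 : ℝ)) ω - 1 := by
    ext ω
    rcases h.label j ω with hω | hω
    · have : ω ∉ A := by simp only [hA, Set.mem_preimage, Set.mem_singleton_iff, hω]; norm_num
      rw [Set.indicator_of_notMem this, hω]; norm_num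
    · have : ω ∈ A := by simp only [hA, Set.mem_preimage, Set.mem_singleton_iff, hω]
      rw [Set.indicator_of_mem this, hω]; norm_num
  have hreg : 2 * (μ[|E]).real A - 1 = Sstar u v := by
    rw [← h.regression j u v, hY, integral_sub, integral_const_mul, integral_indicator hAm]
    · simp [hE]
    · exact ((integrable_const (1 : ℝ)).indicator hAm).const_mul 2
    · exact integrable_const _
  have hEA : μ.real (E ∩ A) = (1 + Sstar u v) / (2 * (Fintype.card V : ℝ) ^ 2) := by
    rw [measureReal_def, cond_apply hEm, ENNReal.toReal_mul, ENNReal.toReal_inv, ← measureReal_def,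
      ← measureReal_def, hEμ] at hreg
    rw [← hreg]; field_simp; ring
  have hsplit : μ.real (E ∩ A) + μ.real (E \ A) = μ.real E := measureReal_inter_add_sdiff hAm
  cases b with
  | true =>
    have : {ω | observation X X' Y ω j = (u, v, true)} = E ∩ A := by
      ext ω; simp [observation, hE, hA, and_assoc]
    rw [this, hEA, obsWeight]; simp [signOf]
  | false =>
    have : {ω | observation X X' Y ω j = (u, v, false)} = E \ A := by
      ext ω; simp [observation, hE, hA, and_assoc]
    rw [this, obsWeight]
    have : μ.real (E \ A) = μ.real E - μ.real (E ∩ A) := by linarith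
    rw [this, hEA, hEμ]
    simp only [signOf, Bool.false_eq_true, if_false]
    field_simp
    ring

/-- Equivalent to |S⋆(u, v)| ≤ 1, which is not assumed but follows once there is an observation
whose probabilities are these weights. -/
lemma IsSample.obsWeight_nonneg [Nonempty V] (h : IsSample μ Sstar X X' Y) (hn : 0 < n)
    (t : V × V × Bool) : 0 ≤ obsWeight Sstar t := by
  rw [← h.measureReal_observation ⟨0, hn⟩ t]; exact measureReal_nonneg

/-- The joint law of the observations. -/
lemma IsSample.measureReal_observation_mem [Nonempty V] (h : IsSample μ Sstar X X' Y)
    (A : Finset (Fin n → V × V × Bool)) :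
    μ.real {ω | observation X X' Y ω ∈ A} = ∑ x ∈ A, ∏ j, obsWeight Sstar (x j) := by
  have hind : iIndepFun (fun j ω => observation X X' Y ω j) μ := by
    have hg : Measurable fun q : V × V × ℝ => (q.1, q.2.1, decide (q.2.2 = 1)) := by
      refine _root_.measurable_fst.prodMk (_root_.measurable_snd.fst.prodMk (measurable_to_bool ?_))
      have : (fun q : V × V × ℝ => decide (q.2.2 = 1)) ⁻¹' {true}
          = (fun q : V × V × ℝ => q.2.2) ⁻¹' {1} := by ext; simp
      rw [this]
      exact _root_.measurable_snd.snd (measurableSet_singleton 1)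
    exact h.indep.comp (fun _ q => (q.1, q.2.1, decide (q.2.2 = 1))) fun _ => hg
  have hset : {ω | observation X X' Y ω ∈ A}
      = ⋃ x ∈ A, ⋂ j ∈ Finset.univ, (fun ω => observation X X' Y ω j) ⁻¹' {x j} := by
    ext ω
    simp only [Set.mem_ofPred_eq, Set.mem_iUnion, Set.mem_iInter, Set.mem_preimage,
      Set.mem_singleton_iff, Finset.mem_univ, forall_true_left, exists_prop]
    constructor
    · exact fun hω => ⟨_, hω, fun _ => rfl⟩
    · rintro ⟨x, hx, he⟩
      rwa [show observation X X' Y ω = x from funext he]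
  rw [hset, measureReal_biUnion_finset]
  · refine Finset.sum_congr rfl fun x _ => ?_
    rw [measureReal_def, hind.measure_inter_preimage_eq_mul Finset.univ
      (fun j _ => measurableSet_singleton (x j)), ENNReal.toReal_prod]
    exact Finset.prod_congr rfl fun j _ => h.measureReal_observation j (x j)
  · intro x _ y _ hxy
    refine Set.disjoint_left.mpr fun ω h1 h2 => hxy (funext fun j => ?_)
    simp only [Set.mem_iInter, Set.mem_preimage, Set.mem_singleton_iff, Finset.mem_univ,
      forall_true_left] at h1 h2
    rw [← h1 j, h2 j]
  · exact fun x _ => Finset.measurableSet_biInter _ fun j _ =>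
      h.measurable_observation j (measurableSet_singleton _)

end Sample

/-! ### Numerical bounds and assembly of the estimate. -/

section Main

open Matrix

/-- Since n, m ≥ 1, the inner logarithm is at least log₂ 4 = 2, and 2m(2 + 2) = 8m. -/
lemma le_tnm {t ζ : ℝ} (hζ : 1 ≤ ζ) {n m : ℕ} (hn : 0 < n) (hm : 0 < m) :
    t + Real.log (8 * m) ≤ tnm t ζ n m := by
  have hn1 : (1 : ℝ) ≤ (n : ℝ) ^ ζ := Real.one_le_rpow (by exact_mod_cast hn) (by linarith)
  have hm1 : (1 : ℝ) ≤ (m : ℝ) ^ (3 / 2 * ζ) := Real.one_le_rpow (by exact_mod_cast hm) (by linarith)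
  have hm0 : (0 : ℝ) < m := by exact_mod_cast hm
  have h4 : (2 : ℝ) ^ (2 : ℝ) ≤ 4 * (n : ℝ) ^ ζ * (m : ℝ) ^ (3 / 2 * ζ) := by
    have : 1 ≤ (n : ℝ) ^ ζ * (m : ℝ) ^ (3 / 2 * ζ) := one_le_mul_of_one_le_of_one_le hn1 hm1
    have e : (2 : ℝ) ^ (2 : ℝ) = 4 := by norm_num
    rw [e]; linarith
  have hlog : 2 ≤ Real.logb 2 (4 * (n : ℝ) ^ ζ * (m : ℝ) ^ (3 / 2 * ζ)) :=
    (Real.le_logb_iff_rpow_le one_lt_two (by positivity)).mpr h4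
  rw [tnm]
  refine add_le_add le_rfl (Real.log_le_log (by positivity) ?_)
  nlinarith

lemma pos_of_card_mul_tnm_le {t ζ : ℝ} (ht : 0 < t) (hζ : 1 ≤ ζ) {n m : ℕ} (hm : 0 < m)
    (h : m * tnm t ζ n m ≤ n) : 0 < n := by
  by_contra hn
  obtain rfl : n = 0 := by omega
  have hm1 : (1 : ℝ) ≤ m := by exact_mod_cast hm
  have hζ0 : ζ ≠ 0 := by linarith
  have : 0 < tnm t ζ 0 m := by
    -- For n = 0 the conventions 0^ζ = 0 and log₂ 0 = 0 turn `tnm` into t + log(4m), still positive,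
    -- which contradicts the assumption.
    rw [tnm, Nat.cast_zero, Real.zero_rpow hζ0, mul_zero, zero_mul, Real.logb_zero, zero_add]
    have := Real.log_nonneg (show (1 : ℝ) ≤ 2 * m * 2 by linarith)
    linarith
  have h2 : 0 < (m : ℝ) * tnm t ζ 0 m := by positivity
  rw [Nat.cast_zero] at h
  linarith

/-- The factor 2m turns e^{-τ}, τ = t + log(2m), into e^{-t}. The surplus 0.01 τ ≥ 0.01 log 2 saves
a share 0.005 of e^{-t}, which pays for the two Frobenius events: there 10u contributes (8m)^{-10}
against m² + 1. -/
lemma failure_probability_le {t u m : ℝ} (ht : 0 < t) (hm : 1 ≤ m) (hu : t + Real.log (8 * m) ≤ u) :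
    2 * m * Real.exp (-(1.01 * (t + Real.log (2 * m)))) + 2 * ((m * m + 1) * Real.exp (-(10 * u)))
      ≤ Real.exp (-t) := by
  have hm0 : 0 < m := by linarith
  have hE := Real.exp_pos (-t)
  have h1 : 2 * m * Real.exp (-(1.01 * (t + Real.log (2 * m)))) ≤ 0.995 * Real.exp (-t) := by
    have e : 2 * m * Real.exp (-(1.01 * (t + Real.log (2 * m))))
        = Real.exp (-t) * Real.exp (-(0.01 * (t + Real.log (2 * m)))) := by
      conv_lhs => rw [← Real.exp_log (show 0 < 2 * m by positivity)]
      rw [← Real.exp_add, ← Real.exp_add, Real.log_exp]; congr 1; ring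
    have hlog : 0.6931471803 ≤ Real.log (2 * m) :=
      Real.log_two_gt_d9.le.trans (Real.log_le_log two_pos (by linarith))
    have h2 : Real.exp (-(0.01 * (t + Real.log (2 * m)))) ≤ 0.995 := by
      calc _ ≤ Real.exp (-0.0069) := by gcongr; linarith
        _ ≤ 0.995 := by
          rw [Real.exp_neg, inv_le_comm₀ (Real.exp_pos _) (by norm_num)]
          refine le_trans ?_ (Real.add_one_le_exp _)
          norm_num
    rw [e]; nlinarith
  have h2 : 2 * ((m * m + 1) * Real.exp (-(10 * u))) ≤ 0.005 * Real.exp (-t) := by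
    have h3 : Real.exp (-(10 * u)) ≤ Real.exp (-t) * (1 / (8 * m) ^ 10) := by
      calc Real.exp (-(10 * u)) ≤ Real.exp (-t + -(10 * Real.log (8 * m))) := by
            gcongr; linarith
        _ = Real.exp (-t) * (1 / (8 * m) ^ 10) := by
            rw [Real.exp_add, Real.exp_neg (10 * _), one_div]
            congr 2
            rw [show (10 : ℝ) * Real.log (8 * m) = (10 : ℕ) * Real.log (8 * m) by norm_num,
              Real.exp_nat_mul, Real.exp_log (by positivity)]
    have h4 : 2 * (m * m + 1) * (1 / (8 * m) ^ 10) ≤ 0.005 := by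
      rw [mul_one_div, div_le_iff₀ (by positivity)]
      have h5 : m ^ 2 ≤ m ^ 10 := pow_le_pow_right₀ hm (by norm_num)
      have h6 : 1 ≤ m ^ 2 := one_le_pow₀ hm
      rw [mul_pow]
      nlinarith
    calc _ ≤ 2 * ((m * m + 1) * (Real.exp (-t) * (1 / (8 * m) ^ 10))) := by gcongr
      _ = 2 * (m * m + 1) * (1 / (8 * m) ^ 10) * Real.exp (-t) := by ring
      _ ≤ _ := by gcongr
  linarith

variable {V : Type*} [Fintype V] [DecidableEq V]

lemma IsSignOf.sum_sq_col {S P G : Matrix V V ℝ} (h : IsSignOf S P G) (v : V) :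
    ∑ i, P i v ^ 2 = projSq (supp S) (EuclideanSpace.single v 1) := by
  have := h.projSq_eq (Pi.single v 1)
  rw [show EuclideanSpace.single v (1 : ℝ) = WithLp.toLp 2 (Pi.single v 1) from rfl, this]
  simp [dotProduct, sq]

lemma IsSignOf.frobSq_proj {S P G : Matrix V V ℝ} (h : IsSignOf S P G) : frobSq P = S.rank := by
  rw [frobSq_eq_trace, h.proj_symm.eq, h.proj_mul_proj, h.trace_proj]

lemma projSq_le_maxCoherence (L : Submodule ℝ (EuclideanSpace ℝ V)) (v : V) :
    projSq L (EuclideanSpace.single v 1) ≤ maxCoherence L :=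
  le_ciSup (f := fun v : V => projSq L (EuclideanSpace.single v 1)) (Set.finite_range _).bddAbove v

/-- The numbers ‖P e_v‖² add up to the rank. Positivity is needed because the Frobenius bound is
applied with √ρ > 0. -/
lemma IsSignOf.maxCoherence_pos {S P G : Matrix V V ℝ} (h : IsSignOf S P G) (hr : 1 ≤ S.rank) :
    0 < maxCoherence (supp S) := by
  by_contra hle
  have h1 : frobSq P ≤ 0 := by
    rw [← frobSq_transpose]
    refine Finset.sum_nonpos fun v _ => ?_
    have := h.sum_sq_col v
    simp only [transpose_apply]
    rw [this]
    exact (projSq_le_maxCoherence _ v).trans (not_lt.mp hle)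
  rw [h.frobSq_proj] at h1
  have : (1 : ℝ) ≤ S.rank := by exact_mod_cast hr
  linarith

lemma sum_sq_row_le {κ : Type*} [Fintype κ] {C : Matrix V κ ℝ}
    (hC : ∀ x, Cᵀ *ᵥ x ⬝ᵥ Cᵀ *ᵥ x ≤ x ⬝ᵥ x) (v : V) : ∑ k, C v k ^ 2 ≤ 1 := by
  have := hC (Pi.single v 1)
  have h1 : (Pi.single v 1 : V → ℝ) ⬝ᵥ Pi.single v 1 = 1 := by simp
  rw [h1] at this
  simpa [dotProduct, sq] using this

lemma IsSignOf.sum_sq_col_compl_le {κ : Type*} [Fintype κ] {S P G : Matrix V V ℝ}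
    (h : IsSignOf S P G) {C : Matrix V κ ℝ} (hC : ∀ x, Cᵀ *ᵥ x ⬝ᵥ Cᵀ *ᵥ x ≤ x ⬝ᵥ x) (u : V) :
    ∑ i, (Cᵀ * (1 - P) : Matrix κ V ℝ) i u ^ 2 ≤ 1 := by
  have h1 := hC ((1 - P) *ᵥ Pi.single u 1)
  have h2 := h.dotProduct_split (Pi.single u 1)
  have h3 := dotProduct_self_nonneg_real (P *ᵥ Pi.single u 1)
  have h4 : (Pi.single u 1 : V → ℝ) ⬝ᵥ Pi.single u 1 = 1 := by simp
  have h5 : ∑ i, (Cᵀ * (1 - P) : Matrix κ V ℝ) i u ^ 2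
      = Cᵀ *ᵥ ((1 - P) *ᵥ Pi.single u 1) ⬝ᵥ Cᵀ *ᵥ ((1 - P) *ᵥ Pi.single u 1) := by
    rw [mulVec_mulVec, mulVec_single_one]
    simp only [dotProduct, col_apply, sq]
  rw [h5]; linarith

lemma IsSignOf.frobSq_compl_le {κ : Type*} [Fintype κ] {S P G : Matrix V V ℝ}
    (h : IsSignOf S P G) (C : Matrix V κ ℝ) : frobSq (Cᵀ * (1 - P)) ≤ frobSq C := by
  have e : frobSq C - frobSq (Cᵀ * (1 - P)) = frobSq (P * C) := by
    rw [← frobSq_transpose (Cᵀ * (1 - P)), frobSq_eq_trace, frobSq_eq_trace, frobSq_eq_trace,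
      ← trace_sub]
    simp only [transpose_mul, transpose_transpose, transpose_sub, transpose_one, h.proj_symm.eq]
    congr 1
    have e1 : Cᵀ * (1 - P) * ((1 - P) * C) = Cᵀ * ((1 - P) * (1 - P)) * C := by
      simp only [Matrix.mul_assoc]
    have e2 : (1 - P) * (1 - P) = 1 - P := by
      rw [Matrix.sub_mul, Matrix.mul_sub, Matrix.mul_sub, h.proj_mul_proj]; simp
    have e3 : Cᵀ * P * (P * C) = Cᵀ * (P * P) * C := by simp only [Matrix.mul_assoc]
    rw [e1, e2, e3, h.proj_mul_proj, Matrix.mul_sub, Matrix.sub_mul, Matrix.mul_one]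
    abel
  linarith [frobSq_nonneg (P * C)]

lemma IsSignOf.frobSq_sign_mul {κ : Type*} [Fintype κ] {S P G : Matrix V V ℝ}
    (h : IsSignOf S P G) (C : Matrix V κ ℝ) : frobSq (G * C) = frobSq (P * C) := by
  rw [frobSq_eq_trace, frobSq_eq_trace, transpose_mul, transpose_mul, h.sign_symm.eq,
    h.proj_symm.eq, Matrix.mul_assoc, ← Matrix.mul_assoc G, h.sign_mul_sign, Matrix.mul_assoc,
    ← Matrix.mul_assoc P P, h.proj_mul_proj]

/-- Collecting the stochastic and the approximation terms. -/
lemma error_terms_le {m n r s ν c τ u ρ a f₁ f₂ f₃ : ℝ} (hm : 0 < m) (hn : 0 < n) (hr : 0 ≤ r)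
    (hs : 0 ≤ s) (hν : 1 ≤ ν) (hc : 0 < c) (hτ : 0 ≤ τ) (hτu : τ ≤ u)
    (ha : a ≤ (1 + c) * s) (hf₁ : f₁ ≤ ν * r / m * a)
    (hf₂ : f₂ ≤ 8 * n * (r * a / m ^ 2) * (10 * u) + 32 * ρ * (10 * u) ^ 2)
    (hf₃ : f₃ ≤ 8 * n * (r * a / m ^ 2) * (10 * u) + 32 * ρ * (10 * u) ^ 2) :
    (4 * Real.sqrt (τ / (n * m))) ^ 2 * m ^ 2 * f₁ + (2 / n) ^ 2 * m ^ 2 * (f₂ + f₃)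
      ≤ 656 * (1 + c) * (ν * r * s * u / n) + 25600 * ρ * (m * u / n) ^ 2 := by
  have hu : 0 ≤ u := hτ.trans hτu
  have e0 : (4 * Real.sqrt (τ / (n * m))) ^ 2 = 16 * (τ / (n * m)) := by
    rw [mul_pow, Real.sq_sqrt (by positivity)]; norm_num
  rw [e0]
  have h1 : 16 * (τ / (n * m)) * m ^ 2 * f₁ ≤ 16 * (1 + c) * (ν * r * s * u / n) := by
    calc _ ≤ 16 * (τ / (n * m)) * m ^ 2 * (ν * r / m * ((1 + c) * s)) := by
          gcongr
          exact hf₁.trans (by gcongr)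
      _ = 16 * (1 + c) * (ν * r * s * τ / n) := by field_simp
      _ ≤ _ := by gcongr
  -- The constants are 320 = 4·8·10 and 12800 = 4·32·100. Two such terms and the 16 from ε² give 656
  -- and 25600; ν ≥ 1 brings the noise terms to the common form.
  have h2 (f : ℝ) (hf : f ≤ 8 * n * (r * a / m ^ 2) * (10 * u) + 32 * ρ * (10 * u) ^ 2) :
      (2 / n) ^ 2 * m ^ 2 * f
        ≤ 320 * (1 + c) * (ν * r * s * u / n) + 12800 * ρ * (m * u / n) ^ 2 := by
    calc _ ≤ (2 / n) ^ 2 * m ^ 2 * (8 * n * (r * ((1 + c) * s) / m ^ 2) * (10 * u)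
          + 32 * ρ * (10 * u) ^ 2) := by
          gcongr
          exact hf.trans (by gcongr)
      _ = 320 * (1 + c) * (1 * r * s * u / n) + 12800 * ρ * (m * u / n) ^ 2 := by
          field_simp; ring
      _ ≤ _ := by gcongr
  have h3 := h2 f₂ hf₂
  have h4 := h2 f₃ hf₃
  rw [mul_add ((2 / n) ^ 2 * m ^ 2)]
  linarith

end Main

end SimilarityKernel

end

open SimilarityKernel in
theorem corollary1 (c : ℝ) (hc : 0 < c) :
    ∃ C C₁ : ℝ, 0 < C ∧ 0 < C₁ ∧
      ∀ (V : Type*) [Fintype V] [DecidableEq V] [MeasurableSpace V] [MeasurableSingletonClass V]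
        (Ω : Type*) [MeasurableSpace Ω] (μ : MeasureTheory.Measure Ω)
        [MeasureTheory.IsProbabilityMeasure μ]
        (ζ : ℝ) (_ : 1 ≤ ζ) (t : ℝ) (_ : 0 < t)
        -- the matrix `W` and its spectrum
        (W : Matrix V V ℝ) (lam : ℕ → ℝ) (phi : ℕ → EuclideanSpace ℝ V) (k₀ : ℕ)
        (_ : IsSpectralRepr W lam phi)
        (_ : SpectrumCondition (Fintype.card V) lam k₀ ζ c)
        -- the target kernel
        (Sstar : Matrix V V ℝ) (_ : Sstar.IsSymm) (_ : 1 ≤ Sstar.rank)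
        -- weak low coherence
        (ν : ℝ) (_ : 1 ≤ ν)
        (_ : ∀ k ∈ Finset.Icc 1 (Fintype.card V),
          ∑ j ∈ Finset.Icc 1 k, projSq (supp Sstar) (phi j)
            ≤ ν * Sstar.rank * k / Fintype.card V)
        -- the constraint set
        (D : Set (Matrix V V ℝ)) (_ : IsClosed D) (_ : Convex ℝ D) (_ : ∀ S ∈ D, S.IsSymm)
        (_ : Sstar ∈ D)
        -- the data
        (n : ℕ) (_ : Fintype.card V * tnm t ζ n (Fintype.card V) ≤ n)
        (X X' : Fin n → Ω → V) (Y : Fin n → Ω → ℝ) (_ : IsSample μ Sstar X X' Y)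
        -- the smoothness parameter
        (s : ℕ) (_ : s ∈ Finset.Icc (k₀ + 1) (Fintype.card V + 1))
        (εbar : ℝ) (_ : εbar ∈ Set.Ioc (invEig (Fintype.card V) lam s)
          (invEig (Fintype.card V) lam (s - 1)))
        -- the estimator
        (Shat : Ω → Matrix V V ℝ)
        (_ : ∀ ω, Shat ω ∈ D ∧
          IsMinOn (risk W (regEps t n (Fintype.card V)) εbar
            (fun j => X j ω) (fun j => X' j ω) (fun j => Y j ω)) D (Shat ω)),
        1 - Real.exp (-t) ≤ μ.real {ω |
          l2Sq (Shat ω - Sstar)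
            ≤ C * (ν * Sstar.rank * s * tnm t ζ n (Fintype.card V) / n)
              + εbar * l2Sq (CFC.sqrt W * Sstar)
              + C₁ * maxCoherence (supp Sstar)
                * (Fintype.card V * tnm t ζ n (Fintype.card V) / n) ^ 2} := by
  refine ⟨656 * (1 + c), 25600, by positivity, by norm_num, ?_⟩
  intro V _ _ _ _ Ω _ μ _ ζ hζ t ht W lam phi k₀ hW hspec Sstar hS hr ν hν hcoh D _ hD hDs hSD n hn
    X X' Y hsample s hs εbar hεbar Shat hShat
  classical
  have hmN : 0 < Fintype.card V := by
    have := Finset.mem_Icc.mp hspec.isLeast.1.1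
    omega
  have : Nonempty V := Fintype.card_pos_iff.mp hmN
  have hm1 : (1 : ℝ) ≤ Fintype.card V := by exact_mod_cast hmN
  have hnN : 0 < n := pos_of_card_mul_tnm_le ht hζ hmN hn
  have hn0 : (0 : ℝ) < n := by exact_mod_cast hnN
  have hu := le_tnm (t := t) hζ hnN hmN
  set m : ℝ := (Fintype.card V : ℝ) with hm
  set u := tnm t ζ n (Fintype.card V) with hu_def
  set τ := t + Real.log (2 * m) with hτ
  have hτ0 : 0 < τ := by
    have := Real.log_nonneg (show (1 : ℝ) ≤ 2 * m by linarith)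
    linarith
  have hτu : τ ≤ u := by
    have := Real.log_le_log (show 0 < 2 * m by linarith) (show 2 * m ≤ 8 * m by linarith)
    linarith
  have hu0 : 0 < u := hτ0.trans_le hτu
  have hεb : 0 ≤ εbar := by
    refine le_trans ?_ hεbar.1.le
    rw [invEig]
    split_ifs with hsm
    · exact inv_nonneg.mpr (hW.nonneg s (Finset.mem_Icc.mpr ⟨by
        have := (Finset.mem_Icc.mp hs).1; omega, hsm⟩))
    · exact le_rfl
  obtain ⟨P, G, hPG⟩ := exists_isSignOf hS
  obtain ⟨C, C', hCC', hC', hPC, hCfrob, hCle⟩ := hW.exists_weight_factors hεb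
  set ρ := maxCoherence (supp Sstar) with hρ_def
  have hρ0 : 0 < ρ := hPG.maxCoherence_pos hr
  have hρsq : Real.sqrt ρ ^ 2 = ρ := Real.sq_sqrt hρ0.le
  have hdim := sum_inv_one_add_le hc hW.nonneg hW.mono hspec hs hεbar.1
  rw [← hCfrob] at hdim
  -- The low coherence condition enters here: the weights 1/(1 + ε̄λ_k) decrease in k and the
  -- partial sums of ‖P φ_k‖² grow at most linearly.
  have hsign : frobSq (G * C) ≤ ν * Sstar.rank / m * frobSq C := by
    rw [hPG.frobSq_sign_mul, hPC, hCfrob]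
    refine sum_mul_le_of_partial_sums ?_ ?_ ?_
    · intro k hk
      have := mul_nonneg hεb (hW.nonneg k hk)
      positivity
    · intro k hk1 hk2
      have h1 := hW.nonneg k (Finset.mem_Icc.mpr ⟨hk1, by omega⟩)
      have h2 := hW.mono k (Finset.mem_Icc.mpr ⟨hk1, by omega⟩) (k + 1)
        (Finset.mem_Icc.mpr ⟨by omega, hk2⟩) (by omega)
      gcongr
    · intro k hk
      refine le_trans (le_of_eq (Finset.sum_congr rfl fun j _ => ?_)) ((hcoh k hk).trans
        (le_of_eq (by ring)))
      rw [← hPG.projSq_eq]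
  have hw := hsample.obsWeight_nonneg hnN
  have hb₁ := sum_prod_filter_noise_opNorm hw hτ0
    ((mul_le_mul_of_nonneg_left hτu (by linarith)).trans hn)
  -- The uniform bound is ‖P e_u‖² ‖Cᵀ e_v‖² ≤ ρ, because C is a contraction. The level 10u makes
  -- the dimension factor m² + 1 negligible.
  have hb₂ := sum_prod_filter_noise_frobSq (n := n) hw P C (ρ := Real.sqrt ρ) (s := 10 * u)
    (Real.sqrt_pos.mpr hρ0) (by positivity) fun a b => by
      rw [hρsq, hPG.sum_sq_col, ← mul_one ρ]
      exact mul_le_mul (projSq_le_maxCoherence _ a) (sum_sq_row_le hCle b)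
        (Finset.sum_nonneg fun _ _ => sq_nonneg _) hρ0.le
  have hb₃ := sum_prod_filter_noise_frobSq (n := n) hw (C.transpose * (1 - P)) P (ρ := Real.sqrt ρ)
    (s := 10 * u) (Real.sqrt_pos.mpr hρ0) (by positivity) fun a b => by
      have hrow : ∑ k, P b k ^ 2 = ∑ k, P k b ^ 2 :=
        Finset.sum_congr rfl fun k _ => by rw [hPG.proj_symm.apply]
      rw [hρsq, hrow, hPG.sum_sq_col, ← one_mul ρ]
      exact mul_le_mul (hPG.sum_sq_col_compl_le hCle a) (projSq_le_maxCoherence _ b)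
        (sq_nonneg _) zero_le_one
  rw [hρsq] at hb₂ hb₃
  have hcard : (Fintype.card (Finset.Icc 1 (Fintype.card V)) : ℝ) = m := by simp [hm]
  rw [hcard] at hb₂ hb₃
  set A₁ := Finset.univ.filter fun x : Fin n → V × V × Bool =>
    ¬ OpNormLE (noise Sstar x) (n * (2 * Real.sqrt (τ / (n * Fintype.card V)))) with hA₁
  set A₂ := Finset.univ.filter fun x : Fin n → V × V × Bool =>
    ¬ frobSq (P * noise Sstar x * C)
      ≤ 8 * n * (frobSq P * frobSq C / (Fintype.card V : ℝ) ^ 2) * (10 * u)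
        + 32 * ρ * (10 * u) ^ 2 with hA₂
  set A₃ := Finset.univ.filter fun x : Fin n → V × V × Bool =>
    ¬ frobSq (C.transpose * (1 - P) * noise Sstar x * P)
      ≤ 8 * n * (frobSq (C.transpose * (1 - P)) * frobSq P / (Fintype.card V : ℝ) ^ 2) * (10 * u)
        + 32 * ρ * (10 * u) ^ 2 with hA₃
  rw [← hsample.measureReal_observation_mem] at hb₁ hb₂ hb₃
  set good := {ω | l2Sq (Shat ω - Sstar)
            ≤ 656 * (1 + c) * (ν * Sstar.rank * s * u / n)
              + εbar * l2Sq (CFC.sqrt W * Sstar)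
              + 25600 * ρ * (m * u / n) ^ 2} with hgood
  -- The estimator is not assumed measurable, so neither is the good event. Covering the whole space
  -- and using monotonicity and subadditivity of μ avoids complements.
  have hcover : (Set.univ : Set Ω) ⊆ good ∪ ({ω | observation X X' Y ω ∈ A₁}
      ∪ ({ω | observation X X' Y ω ∈ A₂} ∪ {ω | observation X X' Y ω ∈ A₃})) := by
    intro ω _
    by_contra hω
    have hω' : ω ∉ good ∧ observation X X' Y ω ∉ A₁ ∧ observation X X' Y ω ∉ A₂
        ∧ observation X X' Y ω ∉ A₃ := by
      simp only [Set.mem_union, not_or] at hω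
      exact hω
    obtain ⟨hg, h₁, h₂, h₃⟩ := hω'
    simp only [hA₁, hA₂, hA₃, Finset.mem_filter, Finset.mem_univ, true_and, not_not] at h₁ h₂ h₃
    refine hg ?_
    set x := observation X X' Y ω with hx
    obtain ⟨hTD, hmin⟩ := hShat ω
    have hY : (fun j => Y j ω) = fun j => signOf (x j).2.2 :=
      funext fun j => (hsample.signOf_decide j ω).symm
    rw [hY] at hmin
    have hε0 : 0 ≤ regEps t n (Fintype.card V) := by
      rw [regEps]; positivity
    have hbasic := basic_inequality hnN hε0 hD hDs hSD hTD x hmin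
    have horacle := oracle_inequality hnN hε0 hεb hW.posSemidef hS (hDs _ hTD) hPG hCC' hC' h₁
      (by rw [regEps]; field_simp; ring) hbasic
    have hf₃ : frobSq (C.transpose * (1 - P) * noise Sstar x * P)
        ≤ 8 * n * (Sstar.rank * frobSq C / m ^ 2) * (10 * u) + 32 * ρ * (10 * u) ^ 2 := by
      refine h₃.trans ?_
      rw [hPG.frobSq_proj, mul_comm (frobSq (C.transpose * (1 - P)))]
      gcongr
      exact hPG.frobSq_compl_le C
    rw [hPG.frobSq_proj] at h₂
    have hfinal := error_terms_le (m := m) (n := n) (r := Sstar.rank) (s := s) (ν := ν) (c := c)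
      (τ := τ) (u := u) (ρ := ρ) (a := frobSq C) (by linarith) hn0 (by positivity) (by positivity)
      hν hc hτ0.le hτu hdim hsign h₂ hf₃
    rw [regEps] at horacle
    show l2Sq (Shat ω - Sstar) ≤ _
    linarith
  have hone : 1 ≤ μ.real good + (μ.real {ω | observation X X' Y ω ∈ A₁}
      + (μ.real {ω | observation X X' Y ω ∈ A₂} + μ.real {ω | observation X X' Y ω ∈ A₃})) := by
    calc (1 : ℝ) = μ.real Set.univ := by simp
      _ ≤ _ := MeasureTheory.measureReal_mono hcover
      _ ≤ _ := (MeasureTheory.measureReal_union_le _ _).trans (by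
          gcongr
          refine (MeasureTheory.measureReal_union_le _ _).trans ?_
          gcongr
          exact MeasureTheory.measureReal_union_le _ _)
  have hfail := failure_probability_le ht hm1 hu
  linarith
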